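/- All graphs are finite and simple. A graph $G$ contains a graph $F$ if $F$ is isomorphic to a (not necessarily induced) subgraph of $G$. A family $\mathcal F$ of graphs always means a non-empty (possibly infinite) family of graphs each of which has at least one edge. A graph $G$ is $\mathcal F$-saturated if $G$ contains no graph in $\mathcal F$ but every graph obtained from $G$ by adding a new edge between two existing vertices contains a graph in $\mathcal F$; $\mathrm{sat}(n,\mathcal F)$ is the minimum number of edges in an $\mathcal F$-saturated graph on $n$ vertices, for integers $n\ge 0$. An interval is a set $I$ of integers such that $a\le b\le c$ with $a,c\in I$ and $b \in \mathbb Z$ implies $b\in I$ (so $\emptyset$ is an interval). **Theorem.** There exist sequences $(a_m)_{m\ge 0}$ and $(b_m)_{m\ge 0}$ of non-negative integers with $a_m\ge b_m$ for all $m$ and, as $m\to\infty$, $$\exp\left[m\log m+O(m)\right]\ \ge\ a_m\ \ge\ b_m\ \ge\ \exp\left[m\log m+O(m\log\log m)\right],$$ such that the following hold. 1. For every family $\mathcal F$ of graphs: (a) $\mathrm{sat}(n,\mathcal F)=O(n)$ as $n\to\infty$; (b) for every integer $m\ge 0$, the set $\{n\in\mathbb Z_{\ge 0}:\mathrm{sat}(n,\mathcal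 F)=m\}$ is the union of at most $a_m$ intervals; (c) $\mathrm{sat}(n,\mathcal F)$ either tends to infinity or is eventually constant as $n\to\infty$. 2. Let $(s_n)_{n\ge 0}$ be a sequence of integers such that (a) $s_n=O(n)$; (b) for every large enough integer $m$, the set $\{n\in\mathbb Z_{\ge 0}:s_n=m\}$ is the union of at most $b_m$ intervals; (c) $s_n\to\infty$ as $n\to\infty$. Then there exists a family $\mathcal F$ of graphs such that $\mathrm{sat}(n,\mathcal F)=s_n$ for all large enough $n$. 3. For every integer $m\ge 0$, there exists a finite family $\mathcal F$ of graphs such that $\mathrm{sat}(n,\mathcal F)=m$ for all large enough $n$. -/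

import Mathlib

open Filter Asymptotics

/-- A finite graph, up to isomorphism: a simple graph on the vertex set `{0, …, k - 1}`. -/
abbrev FinGraph : Type := Σ k : ℕ, SimpleGraph (Fin k)

/-- The families for which saturation numbers are defined: non-empty families of finite graphs,
all of whose members have at least one edge. -/
def IsGraphFamily (𝓕 : Set FinGraph) : Prop :=
  𝓕.Nonempty ∧ ∀ F ∈ 𝓕, F.2.edgeSet.Nonempty

/-- `G` contains (as a not necessarily induced subgraph) a member of `𝓕`. -/
def ContainsMember {V : Type*} (𝓕 : Set FinGraph) (G : SimpleGraph V) : Prop :=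
  ∃ F ∈ 𝓕, F.2.IsContained G

/-- `G` is `𝓕`-saturated: it contains no member of `𝓕`, but adding any new edge creates one. -/
def IsSaturated {V : Type*} (𝓕 : Set FinGraph) (G : SimpleGraph V) : Prop :=
  ¬ ContainsMember 𝓕 G ∧
    ∀ v w : V, v ≠ w → ¬ G.Adj v w → ContainsMember 𝓕 (G ⊔ SimpleGraph.edge v w)

/-- The saturation number: the minimum number of edges of an `𝓕`-saturated graph on `n` vertices
(by `exists_isSaturated` the minimum is over a non-empty set whenever `IsGraphFamily 𝓕`). -/
noncomputable def sat (n : ℕ) (𝓕 : Set FinGraph) : ℕ :=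
  sInf {m : ℕ | ∃ G : SimpleGraph (Fin n), IsSaturated 𝓕 G ∧ G.edgeSet.ncard = m}

theorem exists_isSaturated {𝓕 : Set FinGraph} (h𝓕 : IsGraphFamily 𝓕) (n : ℕ) :
    ∃ G : SimpleGraph (Fin n), IsSaturated 𝓕 G := by
  have hne : {G : SimpleGraph (Fin n) | ¬ ContainsMember 𝓕 G}.Nonempty := by
    refine ⟨⊥, ?_⟩
    rintro ⟨F, hF, ⟨f⟩⟩
    obtain ⟨e, he⟩ := h𝓕.2 F hF
    induction e using Sym2.ind with
    | _ x y => exact f.toHom.map_adj he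
  obtain ⟨G, hG⟩ := (Set.toFinite {G : SimpleGraph (Fin n) | ¬ ContainsMember 𝓕 G}).exists_maximal hne
  refine ⟨G, hG.prop, fun v w hvw hadj => ?_⟩
  by_contra hc
  have hle : G ⊔ SimpleGraph.edge v w ≤ G := hG.le_of_ge hc le_sup_left
  exact hadj (hle (Or.inr ((SimpleGraph.edge_adj v w v w).2 ⟨Or.inl ⟨rfl, rfl⟩, hvw⟩)))

/-- `S` is the union of at most `k` intervals. An interval is an order-convex set of integers,
possibly empty; as `S` consists of non-negative integers, only intervals inside `ℕ` matter. -/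
def IsUnionOfAtMostIntervals (k : ℕ) (S : Set ℕ) : Prop :=
  ∃ 𝓘 : Finset (Set ℕ), 𝓘.card ≤ k ∧ (∀ I ∈ 𝓘, I.OrdConnected) ∧ S = ⋃ I ∈ 𝓘, I

/-! A graph with at most `m` edges is a core on `2 * m` vertices plus isolated vertices. While at
least two isolated vertices remain, freeness passes to smaller `n` and the edge-adding condition to
larger `n`, so each core gives saturated graphs exactly on an interval of `n`
(`ordConnected_isSaturated_sum_bot`). Beyond a short initial range, these intervals determine
whether `sat n 𝓕 = m`. There are only exp(m log m + O(m)) cores, which bounds the number of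
intervals; the dichotomy follows. Linear growth comes from saturating the largest harmless cone.

Conversely, suppose there is an antichain under containment of graphs `H` with `m` edges and large
minimum degree. Give each interval of `{s = m}` its own `H`, and forbid graphs containing `H` once
the order is past the interval, or, from the interval on, once they have more than `m` edges. On its
interval, `H` plus isolated vertices is saturated. A graph with fewer edges has a vertex of bounded
degree, and an edge added there lies in no copy of any member of the antichain
(`exists_family_sat_eq_of_antichain`).

The antichain (`exists_graph_antichain`) consists of blown-up odd cycles carrying an arbitrary
bipartite graph between two consecutive layers. Containment is excluded by cycle length when `√m`
changes, by the number of vertices when only `m` changes, and by choosing isomorphism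
representatives for equal `m`. With O(m / log² m) vertices and O(m / log m) forced edges, the
structure and the division by `v!` cost only a factor exp(O(m)). -/

section Basic

variable {V W : Type*} {𝓕 : Set FinGraph}

theorem ContainsMember.of_isContained {G : SimpleGraph V} {H : SimpleGraph W}
    (h : ContainsMember 𝓕 G) (hGH : G.IsContained H) : ContainsMember 𝓕 H :=
  let ⟨F, hF, hFG⟩ := h
  ⟨F, hF, hFG.trans hGH⟩

theorem IsSaturated.of_iso {G : SimpleGraph V} {H : SimpleGraph W} (e : G ≃g H)
    (h : IsSaturated 𝓕 G) : IsSaturated 𝓕 H := by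
  refine ⟨fun hc => h.1 (hc.of_isContained e.isContained'), fun v w hvw hadj => ?_⟩
  have hadj' : ¬ G.Adj (e.symm v) (e.symm w) := by rwa [e.symm.map_adj_iff]
  refine (h.2 _ _ (fun h => hvw (e.symm.injective h)) hadj').of_isContained
    ⟨⟨⟨e, ?_⟩, e.injective⟩⟩
  intro a b hab
  rw [SimpleGraph.sup_adj, SimpleGraph.edge_adj] at hab ⊢
  rcases hab with hab | ⟨hab, hne⟩
  · exact Or.inl (e.map_adj_iff.2 hab)
  · refine Or.inr ⟨?_, fun h => hne (e.injective h)⟩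
    rcases hab with ⟨rfl, rfl⟩ | ⟨rfl, rfl⟩ <;> simp

theorem SimpleGraph.IsContained.ncard_edgeSet_le [Finite W] {G : SimpleGraph V}
    {H : SimpleGraph W} (h : G.IsContained H) : G.edgeSet.ncard ≤ H.edgeSet.ncard := by
  obtain ⟨f⟩ := h
  rw [← Nat.card_coe_set_eq, ← Nat.card_coe_set_eq]
  exact Nat.card_le_card_of_injective _ f.mapEdgeSet.injective

theorem SimpleGraph.Iso.ncard_edgeSet_eq {G : SimpleGraph V} {H : SimpleGraph W} (e : G ≃g H) :
    G.edgeSet.ncard = H.edgeSet.ncard := by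
  rw [← Nat.card_coe_set_eq, ← Nat.card_coe_set_eq]
  exact Nat.card_congr e.mapEdgeSet

theorem SimpleGraph.ncard_edgeSet_sup_edge [Finite V] {G : SimpleGraph V} {v w : V}
    (hvw : v ≠ w) (h : ¬ G.Adj v w) :
    (G ⊔ SimpleGraph.edge v w).edgeSet.ncard = G.edgeSet.ncard + 1 := by
  rw [SimpleGraph.edgeSet_sup, SimpleGraph.edgeSet_edge_of_ne hvw, Set.union_singleton,
    Set.ncard_insert_of_notMem (by simpa using h) (Set.toFinite _)]

theorem sat_le_of_isSaturated {n : ℕ} {G : SimpleGraph (Fin n)} (h : IsSaturated 𝓕 G) :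
    sat n 𝓕 ≤ G.edgeSet.ncard :=
  Nat.sInf_le ⟨G, h, rfl⟩

theorem exists_isSaturated_ncard_eq_sat (h𝓕 : IsGraphFamily 𝓕) (n : ℕ) :
    ∃ G : SimpleGraph (Fin n), IsSaturated 𝓕 G ∧ G.edgeSet.ncard = sat n 𝓕 :=
  Nat.sInf_mem (s := {m : ℕ | ∃ G : SimpleGraph (Fin n), IsSaturated 𝓕 G ∧ G.edgeSet.ncard = m})
    (let ⟨G, hG⟩ := exists_isSaturated h𝓕 n; ⟨_, G, hG, rfl⟩)

theorem le_sat (h𝓕 : IsGraphFamily 𝓕) {n m : ℕ}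
    (h : ∀ G : SimpleGraph (Fin n), IsSaturated 𝓕 G → m ≤ G.edgeSet.ncard) : m ≤ sat n 𝓕 := by
  obtain ⟨G, hG, he⟩ := exists_isSaturated_ncard_eq_sat h𝓕 n
  exact he ▸ h G hG

theorem not_containsMember_bot (h𝓕 : IsGraphFamily 𝓕) :
    ¬ ContainsMember 𝓕 (⊥ : SimpleGraph V) := by
  rintro ⟨F, hF, ⟨f⟩⟩
  obtain ⟨e, he⟩ := h𝓕.2 F hF
  induction e using Sym2.ind with
  | _ x y => exact f.toHom.map_adj he

theorem exists_isSaturated_ge [Finite V] {G : SimpleGraph V} (hG : ¬ ContainsMember 𝓕 G) :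
    ∃ H : SimpleGraph V, G ≤ H ∧ IsSaturated 𝓕 H := by
  obtain ⟨H, hGH, hH⟩ := (Set.toFinite {H : SimpleGraph V | ¬ ContainsMember 𝓕 H}).exists_le_maximal hG
  refine ⟨H, hGH, hH.prop, fun v w hvw hadj => ?_⟩
  by_contra hc
  have hle : H ⊔ SimpleGraph.edge v w ≤ H := hH.le_of_ge hc le_sup_left
  exact hadj (hle (Or.inr ((SimpleGraph.edge_adj v w v w).2 ⟨Or.inl ⟨rfl, rfl⟩, hvw⟩)))

open Classical in
theorem SimpleGraph.sum_degree_eq_two_mul_ncard [Fintype V] (G : SimpleGraph V) :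
    ∑ v, G.degree v = 2 * G.edgeSet.ncard := by
  rw [G.sum_degrees_eq_twice_card_edges, ← SimpleGraph.coe_edgeFinset, Set.ncard_coe_finset]

end Basic

/-! ### Linear upper bound via cones. -/

section Linear

variable {𝓕 : Set FinGraph}

/-- The graph on `n` vertices whose first `t` vertices are joined to everything, with no other
edges. -/
def coneGraph (t n : ℕ) : SimpleGraph (Fin n) :=
  SimpleGraph.fromRel fun i _ => i.val < t

theorem coneGraph_adj {t n : ℕ} {i j : Fin n} :
    (coneGraph t n).Adj i j ↔ i ≠ j ∧ (i.val < t ∨ j.val < t) := by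
  simp [coneGraph, SimpleGraph.fromRel_adj]

open Classical in
-- If `v` had `N` neighbours outside the first `t` vertices, it would serve as a further apex over
-- them, giving the larger cone.
theorem degree_lt_of_coneGraph_le {t n N : ℕ} {G : SimpleGraph (Fin n)} (hG : coneGraph t n ≤ G)
    (hfree : ¬ (coneGraph (t + 1) N).IsContained G) {v : Fin n} (hv : t ≤ v.val) :
    G.degree v < t + N := by
  by_contra! hdeg
  set B : Finset (Fin n) := (G.neighborFinset v).filter fun w => t ≤ w.val with hB
  have hcard : N ≤ B.card := by
    have h1 : (G.neighborFinset v).card ≤ t + B.card := by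
      rw [← Finset.card_filter_add_card_filter_not (s := G.neighborFinset v) (fun w => w.val < t)]
      refine Nat.add_le_add ?_ (Finset.card_le_card fun w hw => ?_)
      · calc _ ≤ ((Finset.univ : Finset (Fin n)).filter fun w => w.val < t).card :=
              Finset.card_le_card fun w hw => by simp at hw ⊢; exact hw.2
          _ ≤ (Finset.range t).card := Finset.card_le_card_of_injOn Fin.val
              (fun w hw => by simpa using hw) (Fin.val_injective.injOn)
          _ = t := Finset.card_range t
      · simpa [hB] using hw
    rw [SimpleGraph.card_neighborFinset_eq_degree] at h1
    omega
  obtain ⟨e⟩ : Nonempty (Fin N ↪ B) :=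
    Function.Embedding.nonempty_of_card_le (by simpa using hcard)
  have heB : ∀ i, G.Adj v (e i) ∧ t ≤ (e i).1.val := fun i => by
    have h := Finset.mem_filter.1 (e i).2
    exact ⟨(G.mem_neighborFinset v _).1 h.1, h.2⟩
  have hne : ∀ i, (e i).1 ≠ v := fun i h => G.loopless.irrefl v (h ▸ (heB i).1)
  have htn : t ≤ n := hv.trans v.2.le
  let f : Fin N → Fin n := fun i =>
    if h : i.val < t then ⟨i, h.trans_le htn⟩ else if i.val = t then v else e i
  have hf1 : ∀ i, i.val < t → (f i).val = i.val := fun i hi => by simp [f, hi]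
  have hf2 : ∀ i, i.val = t → f i = v := fun i hi => by simp [f, hi]
  have hf3 : ∀ i, t < i.val → f i = e i := fun i hi => by
    simp [f, hi.ne', not_lt.2 hi.le]
  have hft : ∀ i, ¬ i.val < t → t ≤ (f i).val := fun i hi => by
    rcases (not_lt.1 hi).eq_or_lt with h | h
    · rw [hf2 i h.symm]; exact hv
    · rw [hf3 i h]; exact (heB i).2
  have hinj : Function.Injective f := by
    intro i j hij
    have hij' := congrArg Fin.val hij
    by_cases hi : i.val < t <;> by_cases hj : j.val < t
    · rw [hf1 i hi, hf1 j hj] at hij'; exact Fin.ext hij'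
    · have := hft j hj; rw [← hij', hf1 i hi] at this; omega
    · have := hft i hi; rw [hij', hf1 j hj] at this; omega
    · rcases (not_lt.1 hi).eq_or_lt with hi' | hi' <;> rcases (not_lt.1 hj).eq_or_lt with hj' | hj'
      · exact Fin.ext (hi'.symm.trans hj')
      · rw [hf2 i hi'.symm, hf3 j hj'] at hij; exact absurd hij.symm (hne j)
      · rw [hf3 i hi', hf2 j hj'.symm] at hij; exact absurd hij (hne i)
      · rw [hf3 i hi', hf3 j hj'] at hij; exact e.injective (Subtype.ext hij)
  have key : ∀ i j : Fin N, i ≠ j → i.val < t + 1 → G.Adj (f i) (f j) := by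
    intro i j hij hi
    have hfne : f i ≠ f j := fun h => hij (hinj h)
    by_cases hi' : i.val < t
    · exact hG (coneGraph_adj.2 ⟨hfne, Or.inl (by rw [hf1 i hi']; exact hi')⟩)
    · have hit : i.val = t := by omega
      by_cases hj : j.val < t
      · exact hG (coneGraph_adj.2 ⟨hfne, Or.inr (by rw [hf1 j hj]; exact hj)⟩)
      · have hjt : t < j.val := by
          have : i.val ≠ j.val := fun h => hij (Fin.ext h)
          omega
        rw [hf2 i hit, hf3 j hjt]
        exact (heB j).1
  refine hfree ⟨⟨⟨f, ?_⟩, hinj⟩⟩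
  intro i j hij
  obtain ⟨hne, h | h⟩ := coneGraph_adj.1 hij
  · exact key i j hne h
  · exact (key j i hne.symm h).symm

/-- Saturation numbers grow at most linearly. -/
theorem exists_sat_le_mul (h𝓕 : IsGraphFamily 𝓕) : ∃ C : ℕ, ∀ n, sat n 𝓕 ≤ C * n := by
  classical
  -- Take the least number `t + 1` of apices for which some cone contains a member: all cones with
  -- `t` apices are free, so they can be saturated without creating the cone with `t + 1`.
  have hex : ∃ t, ∃ N, ContainsMember 𝓕 (coneGraph t N) := by
    obtain ⟨F, hF⟩ := h𝓕.1
    refine ⟨F.1, F.1, F, hF, SimpleGraph.IsContained.of_le fun i j hij => ?_⟩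
    exact coneGraph_adj.2 ⟨hij.ne, Or.inl i.2⟩
  obtain ⟨t, ht⟩ : ∃ t, Nat.find hex = t + 1 := by
    refine Nat.exists_eq_succ_of_ne_zero fun h0 => ?_
    obtain ⟨N, hN⟩ := (Nat.find_eq_zero hex).1 h0
    refine not_containsMember_bot (V := Fin N) h𝓕 ?_
    convert hN
    ext i j
    simp [coneGraph_adj]
  obtain ⟨N, hN⟩ := ht ▸ Nat.find_spec hex
  have hfree : ∀ n, ¬ ContainsMember 𝓕 (coneGraph t n) := fun n hn =>
    Nat.find_min hex (m := t) (by omega) ⟨n, hn⟩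
  refine ⟨2 * t + N, fun n => ?_⟩
  obtain ⟨G, hle, hG⟩ := exists_isSaturated_ge (hfree n)
  refine (sat_le_of_isSaturated hG).trans ?_
  have hdeg : ∀ v : Fin n, G.degree v ≤ (if v.val < t then n else 0) + (t + N) := by
    intro v
    split_ifs with h
    · have := G.degree_lt_card_verts v
      rw [Fintype.card_fin] at this
      omega
    · have := degree_lt_of_coneGraph_le hle (fun hc => hG.1 (hN.of_isContained hc)) (not_lt.1 h)
      omega
  have hsum := G.sum_degree_eq_two_mul_ncard
  have hfil : ((Finset.univ : Finset (Fin n)).filter fun v => v.val < t).card ≤ t := by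
    calc _ ≤ (Finset.range t).card := Finset.card_le_card_of_injOn Fin.val
          (fun w hw => by simpa using hw) (Fin.val_injective.injOn)
      _ = t := Finset.card_range t
  have hbound : ∑ v, G.degree v ≤ t * n + n * (t + N) := by
    refine (Finset.sum_le_sum fun v _ => hdeg v).trans ?_
    rw [Finset.sum_add_distrib, ← Finset.sum_filter, Finset.sum_const, Finset.sum_const,
      Finset.card_univ, Fintype.card_fin, smul_eq_mul, smul_eq_mul]
    exact Nat.add_le_add_right (Nat.mul_le_mul_right _ hfil) _
  nlinarith

end Linear

/-! ### Counting intervals by their endpoints. -/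

section Intervals

theorem IsUnionOfAtMostIntervals.mono {k l : ℕ} {S : Set ℕ} (h : IsUnionOfAtMostIntervals k S)
    (hkl : k ≤ l) : IsUnionOfAtMostIntervals l S :=
  let ⟨𝓘, hc, hI, hS⟩ := h
  ⟨𝓘, hc.trans hkl, hI, hS⟩

/-- A set of natural numbers is the union of as many intervals as it has left endpoints. -/
theorem isUnionOfAtMostIntervals_of_left_endpoints {S : Set ℕ} (L : Finset ℕ)
    (hzero : 0 ∈ S → 0 ∈ L) (hsucc : ∀ n, n ∉ S → n + 1 ∈ S → n + 1 ∈ L) :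
    IsUnionOfAtMostIntervals L.card S := by
  classical
  -- The interval attached to `l` is the maximal run of `S` starting at `l`.
  refine ⟨L.image fun l => {x | l ≤ x ∧ ∀ y, l ≤ y → y ≤ x → y ∈ S}, Finset.card_image_le, ?_, ?_⟩
  · intro I hI
    obtain ⟨l, -, rfl⟩ := Finset.mem_image.1 hI
    refine ⟨fun x hx y hy z hz => ⟨hx.1.trans hz.1, fun w hlw hwz => hy.2 w hlw (hwz.trans hz.2)⟩⟩
  · ext x
    simp only [Finset.mem_image, Set.iUnion_exists, Set.biUnion_and', Set.iUnion_iUnion_eq_right,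
      Set.mem_iUnion, Set.mem_ofPred_eq, exists_prop]
    constructor
    · intro hx
      induction x with
      | zero =>
        refine ⟨0, hzero hx, le_rfl, fun y _ hy => ?_⟩
        rwa [Nat.le_zero.1 hy]
      | succ n ih =>
        by_cases hn : n ∈ S
        · obtain ⟨l, hl, hln, h⟩ := ih hn
          refine ⟨l, hl, by omega, fun y hly hy => ?_⟩
          rcases Nat.le_succ_iff.1 hy with hy | rfl
          · exact h y hly hy
          · exact hx
        · refine ⟨n + 1, hsucc n hn hx, le_rfl, fun y h1 h2 => ?_⟩
          rwa [le_antisymm h2 h1]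
    · rintro ⟨l, -, hlx, h⟩
      exact h x hlx le_rfl

theorem Set.OrdConnected.succ_mem_unique {S : Set ℕ} (hS : S.OrdConnected) {a b : ℕ}
    (ha : a ∉ S) (ha' : a + 1 ∈ S) (hb : b ∉ S) (hb' : b + 1 ∈ S) : a = b := by
  rcases lt_trichotomy a b with h | h | h
  · exact absurd (hS.out ha' hb' ⟨h, b.le_succ⟩) hb
  · exact h
  · exact absurd (hS.out hb' ha' ⟨h, a.le_succ⟩) ha

theorem Set.OrdConnected.succ_notMem_unique {S : Set ℕ} (hS : S.OrdConnected) {a b : ℕ}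
    (ha : a ∈ S) (ha' : a + 1 ∉ S) (hb : b ∈ S) (hb' : b + 1 ∉ S) : a = b := by
  rcases lt_trichotomy a b with h | h | h
  · exact absurd (hS.out ha hb ⟨a.le_succ, h⟩) ha'
  · exact h
  · exact absurd (hS.out hb ha ⟨b.le_succ, h⟩) hb'

/-- If, from `c` on, membership in `S` is determined by membership in finitely many intervals,
then `S` is the union of boundedly many intervals. -/
theorem isUnionOfAtMostIntervals_of_determined {ι : Type*} [Fintype ι] {R : ι → Set ℕ}
    (hR : ∀ i, (R i).OrdConnected) {S : Set ℕ} (c : ℕ)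
    (hS : ∀ n, c ≤ n → (∀ i, n ∈ R i ↔ n + 1 ∈ R i) → (n ∈ S ↔ n + 1 ∈ S)) :
    IsUnionOfAtMostIntervals (2 * Fintype.card ι + (c + 1)) S := by
  classical
  -- `true` records entering `R i`, `false` leaving it. Each happens at most once, and from `c` on
  -- `S` can change only at such moments.
  let p : ι × Bool → ℕ → Prop := fun q n =>
    if q.2 then n ∉ R q.1 ∧ n + 1 ∈ R q.1 else n ∈ R q.1 ∧ n + 1 ∉ R q.1
  have hp : ∀ q a b, p q a → p q b → a = b := by
    rintro ⟨i, _ | _⟩ a b ha hb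
    · exact (hR i).succ_notMem_unique ha.1 ha.2 hb.1 hb.2
    · exact (hR i).succ_mem_unique ha.1 ha.2 hb.1 hb.2
  let g : ι × Bool → ℕ := fun q => if h : ∃ n, p q n then h.choose + 1 else 0
  have hg : ∀ q n, p q n → g q = n + 1 := fun q n hn => by
    have h : ∃ n, p q n := ⟨n, hn⟩
    simp only [g, dif_pos h, hp q _ _ h.choose_spec hn]
  refine (isUnionOfAtMostIntervals_of_left_endpoints (Finset.univ.image g ∪ Finset.range (c + 1))
    ?_ ?_).mono ?_
  · simp
  · intro n hn hn'
    rw [Finset.mem_union]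
    by_cases hc : c ≤ n
    · left
      have hnot : ¬ ∀ i, n ∈ R i ↔ n + 1 ∈ R i := fun h => hn ((hS n hc h).2 hn')
      push Not at hnot
      obtain ⟨i, h | h⟩ := hnot
      · exact Finset.mem_image.2 ⟨(i, false), Finset.mem_univ _, hg _ _ (by simpa [p] using h)⟩
      · exact Finset.mem_image.2 ⟨(i, true), Finset.mem_univ _, hg _ _ (by simpa [p] using h)⟩
    · right
      simp only [Finset.mem_range]
      omega
  · refine (Finset.card_union_le _ _).trans (Nat.add_le_add ?_ (by simp))
    refine Finset.card_image_le.trans ?_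
    simp [Fintype.card_prod, mul_comm]

/-- A sequence whose level sets are finite unions of intervals tends to infinity or is eventually
constant. -/
theorem tendsto_atTop_or_eventually_eq {f : ℕ → ℕ} {a : ℕ → ℕ}
    (h : ∀ m, IsUnionOfAtMostIntervals (a m) {n | f n = m}) :
    Tendsto f atTop atTop ∨ ∃ c, ∀ᶠ n in atTop, f n = c := by
  by_cases hinf : ∃ m, {n | f n = m}.Infinite
  · right
    obtain ⟨m, hm⟩ := hinf
    obtain ⟨𝓘, -, hI, hS⟩ := h m
    -- One of finitely many intervals covering an infinite level set is infinite, and by convexity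
    -- it contains a whole tail.
    obtain ⟨I, hI𝓘, hIinf⟩ : ∃ I ∈ 𝓘, I.Infinite := by
      by_contra! hfin
      exact hm (hS ▸ 𝓘.finite_toSet.biUnion fun I hI => hfin I hI)
    obtain ⟨x, hx⟩ := hIinf.nonempty
    refine ⟨m, eventually_atTop.2 ⟨x, fun n hn => ?_⟩⟩
    obtain ⟨y, hy, hny⟩ := hIinf.exists_gt n
    have hmem : n ∈ {n | f n = m} := by
      rw [hS]
      exact Set.mem_biUnion hI𝓘 ((hI I hI𝓘).out hx hy ⟨hn, hny.le⟩)
    exact hmem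
  · left
    simp only [not_exists, Set.not_infinite] at hinf
    refine tendsto_atTop.2 fun b => ?_
    have hfin : {n | f n < b}.Finite := by
      have : {n | f n < b} = ⋃ m ∈ Set.Iio b, {n | f n = m} := by ext; simp
      rw [this]
      exact (Set.finite_Iio b).biUnion fun m _ => hinf m
    filter_upwards [hfin.eventually_cofinite_notMem.filter_mono Nat.cofinite_eq_atTop.ge] with n hn
    simpa using hn

end Intervals

/-! ### Level sets of the saturation number. -/

section Levels

variable {𝓕 : Set FinGraph}

theorem exists_embedding_fin_mem_range {r s : ℕ} (hr : 2 ≤ r) (hrs : r ≤ s) (x y : Fin s) :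
    ∃ f : Fin r ↪ Fin s, x ∈ Set.range f ∧ y ∈ Set.range f := by
  classical
  obtain ⟨T, hT, -, hcard⟩ := Finset.exists_subsuperset_card_eq (n := r)
    (Finset.subset_univ ({x, y} : Finset (Fin s))) (Finset.card_le_two.trans hr) (by simpa using hrs)
  let e : Fin r ≃ T := (T.equivFinOfCardEq hcard).symm
  refine ⟨e.toEmbedding.trans (Function.Embedding.subtype _), ⟨e.symm ⟨x, hT (by simp)⟩, by simp⟩,
    ⟨e.symm ⟨y, hT (by simp)⟩, by simp⟩⟩

/-- Adding isolated vertices to a graph, keeping at least two of them, interacts with saturation in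
a convex way. -/
theorem ordConnected_isSaturated_sum_bot {v : ℕ} (K : SimpleGraph (Fin v)) (d : ℕ) :
    {n | d + 2 ≤ n ∧ IsSaturated 𝓕 (K ⊕g (⊥ : SimpleGraph (Fin (n - d))))}.OrdConnected := by
  refine ⟨fun a ha c hc b hb => ⟨ha.1.trans hb.1, fun hcon => ?_, ?_⟩⟩
  · refine hc.2.1 (hcon.of_isContained ?_)
    have hle : b - d ≤ c - d := Nat.sub_le_sub_right hb.2 d
    refine ⟨⟨SimpleGraph.Hom.sum SimpleGraph.Hom.id ⟨Fin.castLE hle, by simp⟩, ?_⟩⟩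
    exact Sum.map_injective.2 ⟨Function.injective_id, Fin.castLE_injective hle⟩
  · have hle : a - d ≤ b - d := Nat.sub_le_sub_right hb.1 d
    have h2 : 2 ≤ a - d := by have := ha.1; omega
    -- A pair of vertices uses at most two isolated ones, so it already lies in a copy of the
    -- smaller graph; this is where `d + 2 ≤ n` is needed.
    have key : ∀ x y : Fin v ⊕ Fin (b - d), ∃ f : Fin (a - d) ↪ Fin (b - d),
        x ∈ Set.range (Sum.map id f : Fin v ⊕ Fin (a - d) → _) ∧
        y ∈ Set.range (Sum.map id f : Fin v ⊕ Fin (a - d) → _) := by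
      have h0 : 0 < b - d := by omega
      intro x y
      obtain ⟨f, hx, hy⟩ := exists_embedding_fin_mem_range h2 hle
        (Sum.elim (fun _ => ⟨0, h0⟩) id x) (Sum.elim (fun _ => ⟨0, h0⟩) id y)
      refine ⟨f, ?_, ?_⟩
      · rcases x with x | x
        · exact ⟨Sum.inl x, rfl⟩
        · obtain ⟨z, hz⟩ := hx
          exact ⟨Sum.inr z, by simpa using hz⟩
      · rcases y with y | y
        · exact ⟨Sum.inl y, rfl⟩
        · obtain ⟨z, hz⟩ := hy
          exact ⟨Sum.inr z, by simpa using hz⟩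
    intro x y hxy hadj
    obtain ⟨f, ⟨x, rfl⟩, ⟨y, rfl⟩⟩ := key x y
    have hinj : Function.Injective (Sum.map id f : Fin v ⊕ Fin (a - d) → Fin v ⊕ Fin (b - d)) :=
      Sum.map_injective.2 ⟨Function.injective_id, f.injective⟩
    have hadj' : ∀ x y, (K ⊕g (⊥ : SimpleGraph (Fin (a - d)))).Adj x y →
        (K ⊕g (⊥ : SimpleGraph (Fin (b - d)))).Adj (Sum.map id f x) (Sum.map id f y) := by
      rintro (x | x) (y | y) <;> simp
    refine (ha.2.2 x y (fun h => hxy (h ▸ rfl)) fun h => hadj (hadj' _ _ h)).of_isContained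
      ⟨⟨⟨Sum.map id f, ?_⟩, hinj⟩⟩
    intro p q hpq
    rw [SimpleGraph.sup_adj, SimpleGraph.edge_adj] at hpq ⊢
    rcases hpq with hpq | ⟨hpq, hne⟩
    · exact Or.inl (hadj' _ _ hpq)
    · refine Or.inr ⟨?_, fun h => hne (hinj h)⟩
      rcases hpq with ⟨rfl, rfl⟩ | ⟨rfl, rfl⟩ <;> simp

open Classical in
theorem SimpleGraph.card_filter_degree_pos_le {V : Type*} [Fintype V] (G : SimpleGraph V) :
    (Finset.univ.filter fun v => 0 < G.degree v).card ≤ 2 * G.edgeSet.ncard := by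
  rw [← G.sum_degree_eq_two_mul_ncard, Finset.card_filter]
  refine Finset.sum_le_sum fun v _ => ?_
  split_ifs <;> omega

/-- A graph with few edges consists of a graph on few vertices and isolated vertices. -/
theorem SimpleGraph.exists_iso_sum_bot {n d : ℕ} (hdn : d ≤ n) (G : SimpleGraph (Fin n))
    (hG : 2 * G.edgeSet.ncard ≤ d) :
    ∃ K : SimpleGraph (Fin d), Nonempty ((K ⊕g (⊥ : SimpleGraph (Fin (n - d)))) ≃g G) := by
  classical
  obtain ⟨T, hT, -, hcard⟩ := Finset.exists_subsuperset_card_eq (n := d)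
    (Finset.subset_univ (Finset.univ.filter fun v => 0 < G.degree v))
    (G.card_filter_degree_pos_le.trans hG) (by simpa using hdn)
  have hout : ∀ x y, G.Adj x y → x ∈ T := fun x y hxy =>
    hT (Finset.mem_filter.2 ⟨Finset.mem_univ _, (G.degree_pos_iff_exists_adj x).2 ⟨y, hxy⟩⟩)
  let e₁ : Fin d ≃ {x // x ∈ T} := (T.equivFinOfCardEq hcard).symm
  let e₂ : Fin (n - d) ≃ {x // x ∉ T} := (Fintype.equivFinOfCardEq (by
    rw [Fintype.card_subtype_compl, Fintype.card_fin, Fintype.card_coe, hcard])).symm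
  let e : Fin d ⊕ Fin (n - d) ≃ Fin n := (Equiv.sumCongr e₁ e₂).trans (Equiv.sumCompl (· ∈ T))
  refine ⟨G.comap fun i => (e₁ i).1, ⟨⟨e, ?_⟩⟩⟩
  rintro (x | x) (y | y)
  · simp [e]
  · simpa [e] using fun h => (e₂ y).2 (hout _ _ h.symm)
  · simpa [e] using fun h => (e₂ x).2 (hout _ _ h)
  · simpa [e] using fun h => (e₂ x).2 (hout _ _ h)

theorem SimpleGraph.ncard_edgeSet_sum_bot {V W : Type*} (K : SimpleGraph V) :
    (K ⊕g (⊥ : SimpleGraph W)).edgeSet.ncard = K.edgeSet.ncard := by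
  rw [← Nat.card_coe_set_eq, ← Nat.card_coe_set_eq]
  have : IsEmpty (⊥ : SimpleGraph W).edgeSet := by simp
  exact Nat.card_congr (SimpleGraph.edgeSetSumEquiv.trans (Equiv.sumEmpty _ _))

/-- The number of graphs with at most `m` edges on `2 * m` labelled vertices. -/
noncomputable def sparseGraphCount (m : ℕ) : ℕ :=
  Nat.card {K : SimpleGraph (Fin (2 * m)) // K.edgeSet.ncard ≤ m}

theorem isUnionOfAtMostIntervals_sat (h𝓕 : IsGraphFamily 𝓕) (m : ℕ) :
    IsUnionOfAtMostIntervals (2 * sparseGraphCount m + (2 * m + 3)) {n | sat n 𝓕 = m} := by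
  classical
  rw [sparseGraphCount, Nat.card_eq_fintype_card]
  refine isUnionOfAtMostIntervals_of_determined
    (R := fun K : {K : SimpleGraph (Fin (2 * m)) // K.edgeSet.ncard ≤ m} =>
      {n | 2 * m + 2 ≤ n ∧ IsSaturated 𝓕 (K.1 ⊕g (⊥ : SimpleGraph (Fin (n - 2 * m))))})
    (fun K => ordConnected_isSaturated_sum_bot K.1 (2 * m)) (2 * m + 2) ?_
  intro n hn hR
  -- The edge counts `i ≤ m` attained by saturated graphs can be read off from which intervals
  -- contain `n`.
  have main : ∀ n, 2 * m + 2 ≤ n → ∀ i ≤ m, ((∃ G : SimpleGraph (Fin n), IsSaturated 𝓕 G ∧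
      G.edgeSet.ncard = i) ↔ ∃ K : {K : SimpleGraph (Fin (2 * m)) // K.edgeSet.ncard ≤ m},
        K.1.edgeSet.ncard = i ∧ n ∈ {n | 2 * m + 2 ≤ n ∧
          IsSaturated 𝓕 (K.1 ⊕g (⊥ : SimpleGraph (Fin (n - 2 * m))))}) := by
    intro n hn i hi
    constructor
    · rintro ⟨G, hG, hGi⟩
      obtain ⟨K, ⟨e⟩⟩ := G.exists_iso_sum_bot (d := 2 * m) (by omega) (by omega)
      have hK : K.edgeSet.ncard = i := by
        rw [← hGi, ← e.ncard_edgeSet_eq, SimpleGraph.ncard_edgeSet_sum_bot]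
      exact ⟨⟨K, hK.trans_le hi⟩, hK, hn, hG.of_iso e.symm⟩
    · rintro ⟨K, hK, -, hsat⟩
      have hcard : Fintype.card (Fin (2 * m) ⊕ Fin (n - 2 * m)) = Fintype.card (Fin n) := by
        simp only [Fintype.card_sum, Fintype.card_fin]; omega
      let e := SimpleGraph.Iso.map (Fintype.equivOfCardEq hcard)
        (K.1 ⊕g (⊥ : SimpleGraph (Fin (n - 2 * m))))
      exact ⟨_, hsat.of_iso e, by
        rw [← e.ncard_edgeSet_eq, SimpleGraph.ncard_edgeSet_sum_bot, hK]⟩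
  have hiff : ∀ i ≤ m, ((∃ G : SimpleGraph (Fin n), IsSaturated 𝓕 G ∧ G.edgeSet.ncard = i) ↔
      ∃ G : SimpleGraph (Fin (n + 1)), IsSaturated 𝓕 G ∧ G.edgeSet.ncard = i) := fun i hi => by
    rw [main n hn i hi, main (n + 1) (by omega) i hi]
    exact exists_congr fun K => and_congr_right fun _ => hR K
  have hsat : ∀ n, sat n 𝓕 = m ↔
      (∃ G : SimpleGraph (Fin n), IsSaturated 𝓕 G ∧ G.edgeSet.ncard = m) ∧
      ∀ i < m, ¬ ∃ G : SimpleGraph (Fin n), IsSaturated 𝓕 G ∧ G.edgeSet.ncard = i := by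
    intro n
    constructor
    · rintro rfl
      refine ⟨exists_isSaturated_ncard_eq_sat h𝓕 n, ?_⟩
      rintro i hi ⟨G, hG, rfl⟩
      exact absurd (sat_le_of_isSaturated hG) (not_le.2 hi)
    · rintro ⟨⟨G, hG, hGm⟩, h⟩
      refine le_antisymm (hGm ▸ sat_le_of_isSaturated hG) ?_
      by_contra! hlt
      exact h _ hlt (exists_isSaturated_ncard_eq_sat h𝓕 n)
  change sat n 𝓕 = m ↔ sat (n + 1) 𝓕 = m
  rw [hsat, hsat, hiff m le_rfl]
  exact and_congr_right fun _ => forall₂_congr fun i hi => not_congr (hiff i hi.le)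

end Levels

/-! ### Eventually constant saturation numbers. -/

section Constant

theorem SimpleGraph.lt_ncard_edgeSet_top {m n : ℕ} (hn : 2 * m + 2 ≤ n) :
    m < (⊤ : SimpleGraph (Fin n)).edgeSet.ncard := by
  rw [← SimpleGraph.coe_edgeFinset, Set.ncard_coe_finset,
    SimpleGraph.card_edgeFinset_top_eq_card_choose_two, Fintype.card_fin]
  calc m < 2 * m + 1 := by omega
    _ = (2 * m + 1) * 1 := (mul_one _).symm
    _ ≤ (2 * m + 2).choose 2 := by
      rw [Nat.choose_two_right, Nat.le_div_iff_mul_le two_pos]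
      have : 2 * m + 2 - 1 = 2 * m + 1 := by omega
      rw [this]
      nlinarith
    _ ≤ n.choose 2 := Nat.choose_le_choose 2 hn

/-- Every natural number is the eventual value of the saturation number of a finite family. -/
theorem exists_finite_family_sat_eq (m : ℕ) : ∃ 𝓕 : Set FinGraph, IsGraphFamily 𝓕 ∧ 𝓕.Finite ∧
    ∀ᶠ n : ℕ in atTop, sat n 𝓕 = m := by
  classical
  -- Since `m + 1` edges touch at most `2 * m + 2` vertices, finitely many graphs suffice to forbid
  -- `m + 1` edges.
  let 𝓕 : Set FinGraph := {F | F.1 ≤ 2 * m + 2 ∧ m < F.2.edgeSet.ncard}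
  have hcont : ∀ {n : ℕ} (G : SimpleGraph (Fin n)), 2 * m + 2 ≤ n →
      G.edgeSet.ncard = m + 1 → ContainsMember 𝓕 G := by
    intro n G hn hG
    obtain ⟨K, ⟨e⟩⟩ := G.exists_iso_sum_bot (d := 2 * m + 2) hn (by omega)
    refine ⟨⟨_, K⟩, ⟨le_rfl, ?_⟩, SimpleGraph.Embedding.sumInl.isContained.trans e.isContained⟩
    rw [← SimpleGraph.ncard_edgeSet_sum_bot (W := Fin (n - (2 * m + 2))), e.ncard_edgeSet_eq, hG]
    exact m.lt_succ_self
  have hfree : ∀ {n : ℕ} (G : SimpleGraph (Fin n)), G.edgeSet.ncard ≤ m →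
      ¬ ContainsMember 𝓕 G := by
    rintro n G hG ⟨F, ⟨-, hF⟩, hFG⟩
    exact absurd (hF.trans_le hFG.ncard_edgeSet_le) (not_lt.2 hG)
  have hex : ∀ n, 2 * m + 2 ≤ n → ∃ G : SimpleGraph (Fin n), G.edgeSet.ncard = m := by
    intro n hn
    obtain ⟨E, hE, hEm⟩ := Set.exists_subset_card_eq (SimpleGraph.lt_ncard_edgeSet_top hn).le
    refine ⟨SimpleGraph.fromEdgeSet E, ?_⟩
    rw [SimpleGraph.edgeSet_fromEdgeSet, sdiff_eq_left.2, hEm]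
    exact Set.disjoint_left.2 fun e he => by simpa using hE he
  have hfam : IsGraphFamily 𝓕 := by
    refine ⟨⟨⟨2 * m + 2, ⊤⟩, le_rfl, SimpleGraph.lt_ncard_edgeSet_top le_rfl⟩, fun F hF => ?_⟩
    exact (Set.ncard_pos (Set.toFinite _)).1 (m.zero_le.trans_lt hF.2)
  refine ⟨𝓕, hfam, ?_, eventually_atTop.2 ⟨2 * m + 2, fun n hn => le_antisymm ?_ ?_⟩⟩
  · have hfin : (⋃ k ∈ Set.Iic (2 * m + 2),
        Set.range (fun F : SimpleGraph (Fin k) => (⟨k, F⟩ : FinGraph))).Finite :=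
      (Set.finite_Iic (2 * m + 2)).biUnion fun k _ => Set.finite_range _
    refine hfin.subset ?_
    rintro ⟨k, F⟩ hF
    exact Set.mem_biUnion (Set.mem_Iic.2 hF.1) ⟨F, rfl⟩
  · obtain ⟨G, hG⟩ := hex n hn
    rw [← hG]
    exact sat_le_of_isSaturated ⟨hfree G hG.le, fun v w hvw hadj =>
      hcont _ hn (by rw [SimpleGraph.ncard_edgeSet_sup_edge hvw hadj, hG])⟩
  · refine le_sat hfam fun G hG => ?_
    by_contra! hlt
    have hne : G ≠ ⊤ := by
      rintro rfl
      exact absurd (SimpleGraph.lt_ncard_edgeSet_top hn) (not_lt.2 hlt.le)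
    obtain ⟨v, w, hvw, hadj⟩ := SimpleGraph.ne_top_iff_exists_not_adj.1 hne
    refine hfree _ ?_ (hG.2 v w hvw hadj)
    rw [SimpleGraph.ncard_edgeSet_sup_edge hvw hadj]
    exact hlt

end Constant

/-! ### Realizing a sequence from an antichain. -/

section Realization

variable {V W : Type*}

theorem SimpleGraph.sum_ncard_neighborSet [Fintype V] (G : SimpleGraph V) :
    ∑ v, (G.neighborSet v).ncard = 2 * G.edgeSet.ncard := by
  classical
  rw [← G.sum_degree_eq_two_mul_ncard]
  refine Finset.sum_congr rfl fun v _ => ?_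
  rw [← SimpleGraph.card_neighborFinset_eq_degree, ← Set.ncard_coe_finset,
    SimpleGraph.coe_neighborFinset]

theorem SimpleGraph.Copy.ncard_neighborSet_le [Finite W] {G : SimpleGraph V} {H : SimpleGraph W}
    (f : SimpleGraph.Copy G H) (v : V) : (G.neighborSet v).ncard ≤ (H.neighborSet (f v)).ncard := by
  rw [← Nat.card_coe_set_eq, ← Nat.card_coe_set_eq]
  exact Nat.card_le_card_of_injective _ (f.mapNeighborSet v).injective

theorem SimpleGraph.ncard_neighborSet_sup_edge_le [Finite V] (G : SimpleGraph V) (v w : V) :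
    ((G ⊔ SimpleGraph.edge v w).neighborSet v).ncard ≤ (G.neighborSet v).ncard + 1 := by
  refine (Set.ncard_le_ncard (t := insert w (G.neighborSet v)) ?_ (Set.toFinite _)).trans
    (Set.ncard_insert_le _ _)
  intro x hx
  rw [SimpleGraph.mem_neighborSet, SimpleGraph.sup_adj, SimpleGraph.edge_adj] at hx
  rcases hx with hx | ⟨⟨-, hx⟩ | ⟨h1, h2⟩, h3⟩
  · exact Or.inr hx
  · exact Or.inl hx
  · exact absurd h2.symm h3

/-- A copy of a graph of large minimum degree cannot use a new edge at a vertex of small degree. -/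
theorem SimpleGraph.IsContained.of_sup_edge [Finite W] {H : SimpleGraph V} {G : SimpleGraph W}
    {v w : W} (h : H.IsContained (G ⊔ SimpleGraph.edge v w))
    (hdeg : ∀ x, (G.neighborSet v).ncard + 1 < (H.neighborSet x).ncard) : H.IsContained G := by
  obtain ⟨f⟩ := h
  have hf : ∀ x, f x ≠ v := fun x hx => by
    have h1 := f.ncard_neighborSet_le x
    rw [hx] at h1
    exact absurd (h1.trans (G.ncard_neighborSet_sup_edge_le v w)) (not_le.2 (hdeg x))
  refine ⟨⟨⟨f, fun {a b} hab => ?_⟩, f.injective⟩⟩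
  have h1 := f.toHom.map_adj hab
  rw [SimpleGraph.sup_adj, SimpleGraph.edge_adj] at h1
  rcases h1 with h1 | ⟨⟨h1, -⟩ | ⟨-, h1⟩, -⟩
  · exact h1
  · exact absurd h1 (hf a)
  · exact absurd h1 (hf b)

/-- Without isolated vertices in `H`, a copy cannot use the vertices outside the range of `f`. -/
theorem SimpleGraph.IsContained.of_map {U : Type*} {H : SimpleGraph U} {G : SimpleGraph V}
    {f : V ↪ W} (h : H.IsContained (G.map f)) (hH : ∀ x, ∃ y, H.Adj x y) : H.IsContained G := by
  obtain ⟨g⟩ := h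
  have hg : ∀ x, ∃ u, f u = g x := fun x => by
    obtain ⟨y, hxy⟩ := hH x
    obtain ⟨u, v, -, hu, -⟩ := (SimpleGraph.map_adj f G _ _).1 (g.toHom.map_adj hxy)
    exact ⟨u, hu⟩
  choose p hp using hg
  refine ⟨⟨⟨p, fun {a b} hab => ?_⟩, fun a b hab => g.injective ?_⟩⟩
  · rw [← SimpleGraph.map_adj_apply (f := f), hp, hp]
    exact g.toHom.map_adj hab
  · change p a = p b at hab
    change g a = g b
    rw [← hp, ← hp, hab]

theorem SimpleGraph.ncard_edgeSet_map (G : SimpleGraph V) (f : V ↪ W) :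
    (G.map f).edgeSet.ncard = G.edgeSet.ncard := by
  rw [SimpleGraph.edgeSet_map]
  exact Set.ncard_image_of_injective _ f.sym2Map.injective

theorem SimpleGraph.exists_ncard_neighborSet_le {n C : ℕ} (G : SimpleGraph (Fin n))
    (hG : G.edgeSet.ncard < C * n) : ∃ v, (G.neighborSet v).ncard ≤ 2 * C := by
  by_contra! h
  have h1 := G.sum_ncard_neighborSet
  have h2 : ∑ _v : Fin n, 2 * C ≤ ∑ v, (G.neighborSet v).ncard :=
    Finset.sum_le_sum fun v _ => (h v).le
  rw [Finset.sum_const, Finset.card_univ, Fintype.card_fin, smul_eq_mul] at h2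
  nlinarith

/-- A sequence of linear growth tending to infinity is eventually the saturation number of a
family, if its level sets are unions of few intervals in terms of an antichain of graphs of
large minimum degree. -/
theorem exists_family_sat_eq_of_antichain {𝓗 : ℕ → Finset FinGraph} {D : ℕ → ℕ}
    (hD : Tendsto D atTop atTop) (hedge : ∀ m, ∀ H ∈ 𝓗 m, H.2.edgeSet.ncard = m)
    (hdeg : ∀ m, ∀ H ∈ 𝓗 m, ∀ v, D m ≤ (H.2.neighborSet v).ncard)
    (hanti : ∀ m m', ∀ H ∈ 𝓗 m, ∀ H' ∈ 𝓗 m', H.2.IsContained H'.2 → H = H')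
    {s : ℕ → ℤ} (hO : (fun n : ℕ => (s n : ℝ)) =O[atTop] (fun n : ℕ => (n : ℝ)))
    (hI : ∀ᶠ m : ℕ in atTop, IsUnionOfAtMostIntervals (𝓗 m).card {n : ℕ | s n = (m : ℤ)})
    (hs : Tendsto s atTop atTop) :
    ∃ 𝓕 : Set FinGraph, IsGraphFamily 𝓕 ∧ ∀ᶠ n : ℕ in atTop, (sat n 𝓕 : ℤ) = s n := by
  classical
  obtain ⟨C, hC⟩ : ∃ C : ℕ, ∀ᶠ n : ℕ in atTop, s n ≤ C * n := by
    obtain ⟨c, hc⟩ := hO.bound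
    refine ⟨⌈c⌉₊, hc.mono fun n hn => ?_⟩
    have h1 : (s n : ℝ) ≤ ⌈c⌉₊ * n := by
      refine (le_abs_self _).trans (hn.trans ?_)
      rw [Real.norm_natCast]
      exact mul_le_mul_of_nonneg_right (Nat.le_ceil c) n.cast_nonneg
    exact_mod_cast h1
  -- Fewer than `C * n` edges force a vertex of degree at most `2 * C`; after one added edge its
  -- degree is still below `2 * C + 2`.
  obtain ⟨m₁, hm₁⟩ := eventually_atTop.1
    ((hD.eventually_ge_atTop (2 * C + 2)).and (hI.and (eventually_ge_atTop 1)))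
  -- `A` pairs each interval of the level set with its own member of `𝓗 m`.
  have hpair : ∀ m, ∃ A : Set (Set ℕ × FinGraph), (∀ q ∈ A, m₁ ≤ m ∧ q.1.OrdConnected ∧ q.2 ∈ 𝓗 m ∧
      ∀ x ∈ q.1, s x = m) ∧ (∀ q ∈ A, ∀ q' ∈ A, q.2 = q'.2 → q = q') ∧
      (m₁ ≤ m → ∀ n, s n = m → ∃ q ∈ A, n ∈ q.1) := by
    intro m
    by_cases hm : m₁ ≤ m
    · obtain ⟨𝓘, hcard, hconn, hU⟩ := (hm₁ m hm).2.1
      obtain ⟨φ⟩ : Nonempty (𝓘 ↪ 𝓗 m) :=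
        Function.Embedding.nonempty_of_card_le (by simpa using hcard)
      have hmem : ∀ x, s x = m ↔ ∃ J ∈ 𝓘, x ∈ J := fun x => by
        have := Set.ext_iff.1 hU x
        simpa using this
      refine ⟨Set.range fun J : 𝓘 => (J.1, (φ J).1), ?_, ?_, ?_⟩
      · rintro _ ⟨J, rfl⟩
        exact ⟨hm, hconn _ J.2, (φ J).2, fun x hx => (hmem x).2 ⟨J.1, J.2, hx⟩⟩
      · rintro _ ⟨J, rfl⟩ _ ⟨J', rfl⟩ h
        rw [φ.injective (Subtype.ext h)]
      · intro _ n hn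
        obtain ⟨J, hJ, hnJ⟩ := (hmem n).1 hn
        exact ⟨_, ⟨⟨J, hJ⟩, rfl⟩, hnJ⟩
    · exact ⟨∅, by simp, by simp, fun h => absurd h hm⟩
  choose A hA hAinj hAmem using hpair
  -- The condition is preserved by passing to containing graphs, so containing a member reduces to
  -- the same condition on the graph itself (`hcm`).
  let 𝓕 : Set FinGraph := {F | ∃ m, ∃ q ∈ A m, q.2.2.IsContained F.2 ∧
    ((∀ x ∈ q.1, x < F.1) ∨ ((∃ x ∈ q.1, x ≤ F.1) ∧ m < F.2.edgeSet.ncard))}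
  have hcm : ∀ {n : ℕ} (G : SimpleGraph (Fin n)), ContainsMember 𝓕 G ↔ ∃ m, ∃ q ∈ A m,
      q.2.2.IsContained G ∧
        ((∀ x ∈ q.1, x < n) ∨ ((∃ x ∈ q.1, x ≤ n) ∧ m < G.edgeSet.ncard)) := by
    intro n G
    constructor
    · rintro ⟨F, ⟨m, q, hq, hqF, h⟩, hFG⟩
      have hle : F.1 ≤ n := by
        obtain ⟨f⟩ := hFG
        simpa using Fintype.card_le_of_injective f f.injective
      refine ⟨m, q, hq, hqF.trans hFG, h.imp (fun h x hx => (h x hx).trans_le hle) ?_⟩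
      rintro ⟨⟨x, hx, hxF⟩, hm⟩
      exact ⟨⟨x, hx, hxF.trans hle⟩, hm.trans_le hFG.ncard_edgeSet_le⟩
    · rintro ⟨m, q, hq, hqG, h⟩
      exact ⟨⟨n, G⟩, ⟨m, q, hq, hqG, h⟩, SimpleGraph.IsContained.rfl⟩
  have hlarge : ∀ᶠ n : ℕ in atTop, ∃ m q, s n = (m : ℕ) ∧ q ∈ A m ∧ n ∈ q.1 := by
    filter_upwards [hs.eventually_ge_atTop (m₁ : ℤ)] with n hn
    obtain ⟨m, hm⟩ := Int.eq_ofNat_of_zero_le ((Int.natCast_nonneg m₁).trans hn)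
    obtain ⟨q, hq, hnq⟩ := hAmem m (by omega) n hm
    exact ⟨m, q, hm, hq, hnq⟩
  have hfam : IsGraphFamily 𝓕 := by
    refine ⟨?_, fun F hF => ?_⟩
    · obtain ⟨n, m, q, -, hq, hnq⟩ := hlarge.exists
      refine ⟨⟨n + q.2.1 + (2 * m + 2), ⊤⟩, m, q, hq, ?_, Or.inr ⟨⟨n, hnq, ?_⟩,
        SimpleGraph.lt_ncard_edgeSet_top (by omega)⟩⟩
      · exact SimpleGraph.isContained_top_iff.2
          ⟨Fin.castLEEmb ((Nat.le_add_left _ _).trans (Nat.le_add_right _ _))⟩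
      · exact (Nat.le_add_right _ _).trans (Nat.le_add_right _ _)
    · obtain ⟨m, q, hq, hqF, -⟩ := hF
      have h1 := hqF.ncard_edgeSet_le
      rw [hedge m q.2 (hA m q hq).2.2.1] at h1
      have h2 := (hm₁ m (hA m q hq).1).2.2
      exact (Set.ncard_pos (Set.toFinite _)).1 (by omega)
  refine ⟨𝓕, hfam, ?_⟩
  filter_upwards [hlarge, hC, eventually_ge_atTop (2 * C + 2)] with n ⟨m, q, hsm, hq, hnq⟩ hCn hn
  obtain ⟨hmm, -, hqH, -⟩ := hA m q hq
  have hmC : m ≤ C * n := by rw [hsm] at hCn; exact_mod_cast hCn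
  rw [hsm, Nat.cast_inj]
  apply le_antisymm
  -- Minimum degree `2 * C + 2` and at most `C * n` edges leave room for the graph on `n` vertices.
  · have hcard : q.2.1 ≤ n := by
      have h1 := q.2.2.sum_ncard_neighborSet
      have h2 : ∑ _v : Fin q.2.1, (2 * C + 2) ≤ ∑ v, (q.2.2.neighborSet v).ncard :=
        Finset.sum_le_sum fun v _ => ((hm₁ m hmm).1).trans (hdeg m q.2 hqH v)
      rw [Finset.sum_const, Finset.card_univ, Fintype.card_fin, smul_eq_mul, h1,
        hedge m q.2 hqH] at h2
      by_contra! hlt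
      nlinarith
    let T : SimpleGraph (Fin n) := q.2.2.map (Fin.castLEEmb hcard)
    have hTm : T.edgeSet.ncard = m := by
      rw [SimpleGraph.ncard_edgeSet_map, hedge m q.2 hqH]
    have hqT : q.2.2.IsContained T := (SimpleGraph.Embedding.map _ _).isContained
    rw [← hTm]
    refine sat_le_of_isSaturated ⟨fun hc => ?_, fun v w hvw hadj => ?_⟩
    · obtain ⟨m', q', hq', hq'T, h⟩ := (hcm T).1 hc
      obtain ⟨hmm', -, hqH', -⟩ := hA m' q' hq'
      have hpos : ∀ x, ∃ y, q'.2.2.Adj x y := fun x => by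
        have h1 : 0 < (q'.2.2.neighborSet x).ncard := by
          have h2 := ((hm₁ m' hmm').1).trans (hdeg m' q'.2 hqH' x)
          omega
        exact (Set.ncard_pos (Set.toFinite _)).1 h1
      have heq : q'.2 = q.2 := hanti m' m _ hqH' _ hqH (hq'T.of_map hpos)
      have hmeq : m' = m := by rw [← hedge m' q'.2 hqH', heq, hedge m q.2 hqH]
      subst hmeq
      have hqq : q' = q := hAinj _ q' hq' q hq heq
      subst hqq
      rcases h with h | h
      · exact lt_irrefl _ (h n hnq)
      · exact absurd h.2 (not_lt.2 hTm.le)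
    · refine (hcm _).2 ⟨m, q, hq, hqT.mono_right le_sup_left, Or.inr ⟨⟨n, hnq, le_rfl⟩, ?_⟩⟩
      rw [SimpleGraph.ncard_edgeSet_sup_edge hvw hadj, hTm]
      exact m.lt_succ_self
  · refine le_sat hfam fun G hG => ?_
    by_contra! hlt
    obtain ⟨v, hv⟩ := G.exists_ncard_neighborSet_le (hlt.trans_le hmC)
    obtain ⟨w, hw⟩ : ∃ w, w ∉ insert v (G.neighborSet v) := by
      by_contra! hall
      have h1 : (insert v (G.neighborSet v)).ncard = n := by
        rw [Set.eq_univ_of_forall hall, Set.ncard_univ, Nat.card_eq_fintype_card, Fintype.card_fin]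
      have h2 := Set.ncard_insert_le v (G.neighborSet v)
      omega
    rw [Set.mem_insert_iff, not_or, SimpleGraph.mem_neighborSet] at hw
    obtain ⟨m', q', hq', hq'G, h⟩ := (hcm _).1 (hG.2 v w (Ne.symm hw.1) hw.2)
    obtain ⟨hmm', hconn, hqH', hsq'⟩ := hA m' q' hq'
    have hq'G' : q'.2.2.IsContained G := hq'G.of_sup_edge fun x => by
      have h2 := ((hm₁ m' hmm').1).trans (hdeg m' q'.2 hqH' x)
      omega
    -- The copy is already in `G`, so `n` is not past the interval; nor is it before it, so `n` lies
    -- inside, whence `m' = m` and `G` has at least `m` edges.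
    have hnot : ¬ ∀ x ∈ q'.1, x < n := fun h' => hG.1 ((hcm G).2 ⟨m', q', hq', hq'G', Or.inl h'⟩)
    obtain ⟨⟨x, hx, hxn⟩, -⟩ := h.resolve_left hnot
    push Not at hnot
    obtain ⟨y, hy, hny⟩ := hnot
    have hsn := hsq' n (hconn.out hx hy ⟨hxn, hny⟩)
    have hmeq : m' = m := by rw [hsm] at hsn; exact_mod_cast hsn.symm
    have h3 := hq'G'.ncard_edgeSet_le
    rw [hedge m' q'.2 hqH', hmeq] at h3
    omega

end Realization

/-! ### Homomorphisms between odd cycles. -/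

section OddCycles

/-- There is no homomorphism from an odd cycle to a longer odd cycle. -/
theorem not_forall_sub_eq_one_of_lt {k l : ℕ} (hkl : k < l) (f : ZMod (2 * k + 3) → ZMod (2 * l + 3))
    (hf : ∀ i, f i - f (i + 1) = 1 ∨ f (i + 1) - f i = 1) : False := by
  have h : ∀ i, ∃ δ : ℤ, 0 ≤ δ ∧ δ ≤ 1 ∧ ((1 - 2 * δ : ℤ) : ZMod (2 * l + 3)) = f (i + 1) - f i := by
    intro i
    rcases hf i with h | h
    · refine ⟨1, by norm_num, by norm_num, ?_⟩
      rw [← neg_sub (f i), h]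
      norm_num
    · exact ⟨0, by norm_num, by norm_num, by rw [h]; norm_num⟩
  choose δ h0 h1 h2 using h
  -- The signed steps telescope around the cycle. Their integer sum has absolute value at most `2 *
  -- k + 3`, hence would be zero, yet it is odd.
  have hsum : ((∑ i, (1 - 2 * δ i) : ℤ) : ZMod (2 * l + 3)) = 0 := by
    rw [Int.cast_sum, Finset.sum_congr rfl fun i _ => h2 i, Finset.sum_sub_distrib, sub_eq_zero]
    exact Equiv.sum_comp (Equiv.addRight (1 : ZMod (2 * k + 3))) f
  rw [ZMod.intCast_zmod_eq_zero_iff_dvd, Finset.sum_sub_distrib, ← Finset.mul_sum, Finset.sum_const,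
    Finset.card_univ, ZMod.card, nsmul_eq_mul, mul_one] at hsum
  have hl : 0 ≤ ∑ i, δ i := Finset.sum_nonneg fun i _ => h0 i
  have hu : ∑ i, δ i ≤ ((2 * k + 3 : ℕ) : ℤ) := by
    calc ∑ i, δ i ≤ ∑ _i : ZMod (2 * k + 3), (1 : ℤ) := Finset.sum_le_sum fun i _ => h1 i
      _ = _ := by rw [Finset.sum_const, Finset.card_univ, ZMod.card, nsmul_eq_mul, mul_one]
  have := Int.eq_zero_of_abs_lt_dvd hsum (by rw [abs_lt]; push_cast at *; constructor <;> omega)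
  push_cast at this
  omega

end OddCycles

/-! ### Blown-up odd cycles carrying a bipartite graph. -/

section LayerGraph

variable {k D N N' : ℕ}

/-- The vertices of a layered graph: `D` core vertices in each of `2 * k + 3` cyclically arranged
layers, and `N` and `N'` further vertices in two consecutive layers. -/
abbrev LayerVertex (k D N N' : ℕ) : Type := (ZMod (2 * k + 3) × Fin D) ⊕ (Fin N ⊕ Fin N')

def LayerVertex.layer : LayerVertex k D N N' → ZMod (2 * k + 3)
  | .inl p => p.1
  | .inr (.inl _) => 0
  | .inr (.inr _) => 1

theorem zmod_zero_ne_one (k : ℕ) : (0 : ZMod (2 * k + 3)) ≠ 1 := by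
  have : Fact (1 < 2 * k + 3) := ⟨by omega⟩
  exact zero_ne_one

/-- Core vertices are joined to everything in the neighbouring layers. -/
def layerCore (k D N N' : ℕ) : SimpleGraph (LayerVertex k D N N') where
  Adj u v := (LayerVertex.layer u - LayerVertex.layer v = 1 ∨
    LayerVertex.layer v - LayerVertex.layer u = 1) ∧ (u.isLeft ∨ v.isLeft)
  symm := ⟨fun _ _ h => ⟨h.1.symm, h.2.symm⟩⟩
  loopless := ⟨fun u h => by simpa [zmod_zero_ne_one] using h.1⟩

def layerEdge (k D N N' : ℕ) (p : Fin N × Fin N') : Sym2 (LayerVertex k D N N') :=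
  s(.inr (.inl p.1), .inr (.inr p.2))

theorem layerEdge_injective : Function.Injective (layerEdge k D N N') := by
  rintro ⟨a, b⟩ ⟨c, d⟩ h
  simpa [layerEdge] using h

/-- The layered graph with a prescribed bipartite graph between the non-core vertices. -/
def layerGraph (k D : ℕ) {N N' : ℕ} (S : Finset (Fin N × Fin N')) :
    SimpleGraph (LayerVertex k D N N') :=
  layerCore k D N N' ⊔ SimpleGraph.fromEdgeSet (layerEdge k D N N' '' S)

variable (k D) in
theorem edgeSet_layerGraph (S : Finset (Fin N × Fin N')) :
    (layerGraph k D S).edgeSet = (layerCore k D N N').edgeSet ∪ layerEdge k D N N' '' S := by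
  rw [layerGraph, SimpleGraph.edgeSet_sup, SimpleGraph.edgeSet_fromEdgeSet, sdiff_eq_left.2]
  rw [Set.disjoint_left]
  rintro _ ⟨p, -, rfl⟩
  simp [layerEdge]

theorem layerEdge_notMem_layerCore (p : Fin N × Fin N') :
    layerEdge k D N N' p ∉ (layerCore k D N N').edgeSet := by
  simp [layerEdge, layerCore]

variable (k D) in
theorem ncard_edgeSet_layerGraph (S : Finset (Fin N × Fin N')) :
    (layerGraph k D S).edgeSet.ncard = (layerCore k D N N').edgeSet.ncard + S.card := by
  rw [edgeSet_layerGraph, Set.ncard_union_eq, Set.ncard_image_of_injective _ layerEdge_injective,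
    Set.ncard_coe_finset]
  rw [Set.disjoint_right]
  rintro _ ⟨p, -, rfl⟩
  exact layerEdge_notMem_layerCore p

variable (k D N N') in
theorem layerGraph_injective :
    Function.Injective (layerGraph k D : Finset (Fin N × Fin N') → _) := by
  intro S T h
  have key : ∀ (S : Finset (Fin N × Fin N')) p,
      p ∈ S ↔ layerEdge k D N N' p ∈ (layerGraph k D S).edgeSet := by
    intro S p
    rw [edgeSet_layerGraph, Set.mem_union, layerEdge_injective.mem_set_image]
    simp [layerEdge_notMem_layerCore]
  ext p
  rw [key, key, h]

theorem layerGraph_layer_sub {S : Finset (Fin N × Fin N')} {u v : LayerVertex k D N N'}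
    (h : (layerGraph k D S).Adj u v) :
    LayerVertex.layer u - LayerVertex.layer v = 1 ∨
      LayerVertex.layer v - LayerVertex.layer u = 1 := by
  rw [layerGraph, SimpleGraph.sup_adj, SimpleGraph.fromEdgeSet_adj] at h
  rcases h with h | ⟨⟨p, -, hp⟩, -⟩
  · exact h.1
  · rw [layerEdge, Sym2.eq_iff] at hp
    rcases hp with ⟨rfl, rfl⟩ | ⟨rfl, rfl⟩ <;> simp [LayerVertex.layer]

theorem layerGraph_adj_core {S : Finset (Fin N × Fin N')} (u : LayerVertex k D N N') (x : Fin D) :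
    (layerGraph k D S).Adj u (.inl (LayerVertex.layer u + 1, x)) := by
  refine Or.inl ⟨Or.inr ?_, Or.inr rfl⟩
  simp [LayerVertex.layer]

theorem le_ncard_neighborSet_layerGraph (S : Finset (Fin N × Fin N')) (u : LayerVertex k D N N') :
    D ≤ ((layerGraph k D S).neighborSet u).ncard := by
  have hinj : Function.Injective
      fun x : Fin D => (.inl (LayerVertex.layer u + 1, x) : LayerVertex k D N N') := by
    intro x y h
    simpa using h
  calc D = (Set.range fun x : Fin D =>
        (.inl (LayerVertex.layer u + 1, x) : LayerVertex k D N N')).ncard := by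
        rw [← Set.image_univ, Set.ncard_image_of_injective _ hinj, Set.ncard_univ,
          Nat.card_eq_fintype_card, Fintype.card_fin]
    _ ≤ _ := Set.ncard_le_ncard (by rintro _ ⟨x, rfl⟩; exact layerGraph_adj_core u x)
        (Set.toFinite _)

/-- Every edge has a core endpoint, which is fixed by the other endpoint, a direction and an index
below `D`. -/
theorem ncard_edgeSet_layerCore_le :
    (layerCore k D N N').edgeSet.ncard ≤ Fintype.card (LayerVertex k D N N') * (2 * D) := by
  let g : LayerVertex k D N N' × (Bool × Fin D) → Sym2 (LayerVertex k D N N') := fun q =>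
    s(q.1, .inl (if q.2.1 then LayerVertex.layer q.1 + 1 else LayerVertex.layer q.1 - 1, q.2.2))
  have key : ∀ u v : LayerVertex k D N N', (LayerVertex.layer u - LayerVertex.layer v = 1 ∨
      LayerVertex.layer v - LayerVertex.layer u = 1) → v.isLeft → s(u, v) ∈ Set.range g := by
    rintro u (⟨i, x⟩ | v) h hv
    · rcases h with h | h
      · obtain rfl : i = LayerVertex.layer u - 1 := by
          rw [← h]
          exact (sub_sub_cancel _ _).symm
        exact ⟨(u, false, x), rfl⟩
      · obtain rfl : i = LayerVertex.layer u + 1 := by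
          rw [← h]
          exact (add_sub_cancel _ _).symm
        exact ⟨(u, true, x), rfl⟩
    · simp at hv
  have hsub : (layerCore k D N N').edgeSet ⊆ Set.range g := by
    intro e he
    induction e using Sym2.ind with
    | _ u v =>
      obtain ⟨h, hu | hv⟩ := he
      · rw [Sym2.eq_swap]
        exact key v u h.symm hu
      · exact key u v h hv
  calc _ ≤ (Set.range g).ncard := Set.ncard_le_ncard hsub (Set.toFinite _)
    _ ≤ Nat.card (LayerVertex k D N N' × (Bool × Fin D)) := by
      rw [← Set.image_univ, ← Set.ncard_univ]
      exact Set.ncard_image_le (Set.toFinite _)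
    _ = _ := by simp [Nat.card_eq_fintype_card, Fintype.card_prod]

theorem card_layerVertex :
    Fintype.card (LayerVertex k D N N') = (2 * k + 3) * D + (N + N') := by
  simp [ZMod.card]

/-- One core vertex per layer gives a shorter odd cycle; composing the copy with the layer map would
send it to the longer one. -/
theorem not_layerGraph_isContained_of_lt {l D' M M' : ℕ} {S : Finset (Fin N × Fin N')}
    {T : Finset (Fin M × Fin M')} (hD : 0 < D) (hkl : k < l) :
    ¬ (layerGraph k D S).IsContained (layerGraph l D' T) := by
  rintro ⟨f⟩
  refine not_forall_sub_eq_one_of_lt hkl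
    (fun i => LayerVertex.layer (f (.inl (i, ⟨0, hD⟩)))) fun i => ?_
  exact layerGraph_layer_sub (f.toHom.map_adj (layerGraph_adj_core (.inl (i, ⟨0, hD⟩)) ⟨0, hD⟩))

end LayerGraph

/-! ### Isomorphism classes of labelled graphs. -/

section Representatives

variable {V W : Type*}

open scoped Nat in
/-- Representatives of the isomorphism classes in a finite set of labelled graphs. -/
theorem exists_isomorphism_representatives [Fintype V] (𝒢 : Finset (SimpleGraph V)) :
    ∃ 𝓗 : Finset FinGraph, 𝒢.card ≤ (Fintype.card V)! * 𝓗.card ∧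
      (∀ H ∈ 𝓗, ∃ G ∈ 𝒢, Nonempty (G ≃g H.2)) ∧
      ∀ H ∈ 𝓗, ∀ H' ∈ 𝓗, Nonempty (H.2 ≃g H'.2) → H = H' := by
  classical
  let r : Setoid (SimpleGraph V) := ⟨fun G H => Nonempty (G ≃g H),
    fun _ => ⟨.refl⟩, fun ⟨e⟩ => ⟨e.symm⟩, fun ⟨e⟩ ⟨e'⟩ => ⟨e.trans e'⟩⟩
  let f : SimpleGraph V → FinGraph := fun G =>
    ⟨Fintype.card V, (Quotient.mk r G).out.overFin rfl⟩
  have hf : ∀ G, Nonempty (G ≃g (f G).2) := fun G =>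
    let ⟨e⟩ : Nonempty ((Quotient.mk r G).out ≃g G) := Quotient.mk_out (s := r) G
    ⟨e.symm.trans ((Quotient.mk r G).out.overFinIso rfl)⟩
  refine ⟨𝒢.image f, Finset.card_le_mul_card_image _ _ fun H _ => ?_, fun H hH => ?_, ?_⟩
  · rcases (𝒢.filter fun G => f G = H).eq_empty_or_nonempty with h | ⟨G₀, hG₀⟩
    · rw [h]
      exact Nat.zero_le _
    · rw [← Fintype.card_perm, ← Finset.card_univ]
      have hiso : ∀ G, f G = H → ∃ σ : Equiv.Perm V, G.map σ.toEmbedding = G₀ := by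
        intro G hG
        obtain ⟨e⟩ := hf G
        obtain ⟨e₀⟩ := hf G₀
        have hGG : f G = f G₀ := hG.trans (Finset.mem_filter.1 hG₀).2.symm
        rw [hGG] at e
        let e' : G ≃g G₀ := e.trans e₀.symm
        refine ⟨e'.toEquiv, ?_⟩
        ext a b
        rw [SimpleGraph.map_adj]
        constructor
        · rintro ⟨x, y, hxy, rfl, rfl⟩
          exact e'.map_adj_iff.2 hxy
        · intro hab
          exact ⟨e'.symm a, e'.symm b, e'.symm.map_adj_iff.2 hab, e'.apply_symm_apply a,
            e'.apply_symm_apply b⟩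
      let g : SimpleGraph V → Equiv.Perm V := fun G => if h : f G = H then (hiso G h).choose else 1
      refine Finset.card_le_card_of_injOn g (fun _ _ => Finset.mem_univ _) ?_
      have hg : ∀ G, f G = H → G.map (g G).toEmbedding = G₀ := fun G h => by
        simp only [g, dif_pos h]
        exact (hiso G h).choose_spec
      intro G hG G' hG' hgg
      have h1 := hg G (Finset.mem_filter.1 hG).2
      rw [hgg, ← hg G' (Finset.mem_filter.1 hG').2] at h1
      exact SimpleGraph.map_injective _ h1
  · obtain ⟨G, hG, rfl⟩ := Finset.mem_image.1 hH
    exact ⟨G, hG, hf G⟩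
  · intro H hH H' hH' ⟨e⟩
    obtain ⟨G, -, rfl⟩ := Finset.mem_image.1 hH
    obtain ⟨G', -, rfl⟩ := Finset.mem_image.1 hH'
    obtain ⟨e₁⟩ := hf G
    obtain ⟨e₂⟩ := hf G'
    have : (Quotient.mk r G) = Quotient.mk r G' := Quotient.sound ⟨(e₁.trans e).trans e₂.symm⟩
    simp only [f, this]

theorem SimpleGraph.IsContained.nonempty_iso [Finite V] [Finite W] {G : SimpleGraph V}
    {H : SimpleGraph W} (h : G.IsContained H) (hcard : Nat.card W ≤ Nat.card V)
    (hedge : H.edgeSet.ncard ≤ G.edgeSet.ncard) : Nonempty (G ≃g H) := by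
  obtain ⟨f⟩ := h
  have hbij : Function.Bijective f := f.injective.bijective_of_nat_card_le hcard
  have hsurj : Function.Surjective f.mapEdgeSet := by
    refine (f.mapEdgeSet.injective.bijective_of_nat_card_le ?_).2
    rwa [Nat.card_coe_set_eq, Nat.card_coe_set_eq]
  refine ⟨⟨Equiv.ofBijective f hbij, fun {a b} => ⟨fun hab => ?_, fun hab => f.toHom.map_adj hab⟩⟩⟩
  obtain ⟨⟨e, he⟩, hee⟩ := hsurj ⟨s(f a, f b), hab⟩
  have h1 : Sym2.map f e = Sym2.map f s(a, b) := congrArg Subtype.val hee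
  rw [Sym2.map.injective f.injective h1] at he
  exact he

end Representatives

/-! ### The antichain and its parameters. -/

section Antichain

open scoped Nat

/-- The order log m is large enough for forced edges and relabellings to cost only exp(O(m)), and
small enough to keep m² / polylog m free pairs. -/
def coreSize (m : ℕ) : ℕ := Nat.log 2 m.sqrt

def sideSize (m : ℕ) : ℕ := m.sqrt ^ 2 / coreSize m ^ 2

/-- The number of vertices on the longer side; within each range of constant `m.sqrt` it is
strictly decreasing in `m`. -/
def longSideSize (m : ℕ) : ℕ := sideSize m + ((m.sqrt + 1) ^ 2 - m)

abbrev EncodingVertex (m : ℕ) : Type :=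
  LayerVertex m.sqrt (coreSize m) (sideSize m) (longSideSize m)

noncomputable def forcedEdgeCount (m : ℕ) : ℕ :=
  (layerCore m.sqrt (coreSize m) (sideSize m) (longSideSize m)).edgeSet.ncard

theorem card_encodingVertex_lt {m m' : ℕ} (h : m < m') (hs : m.sqrt = m'.sqrt) :
    Fintype.card (EncodingVertex m') < Fintype.card (EncodingVertex m) := by
  have h1 : m' < (m'.sqrt + 1) ^ 2 := Nat.lt_succ_sqrt' m'
  rw [card_layerVertex, card_layerVertex, longSideSize, longSideSize, sideSize, sideSize,
    coreSize, coreSize, hs]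
  omega

/-- An antichain of graphs under containment, of large minimum degree, with many members of each
large size. -/
theorem exists_graph_antichain : ∃ 𝓗 : ℕ → Finset FinGraph,
    (∀ m, ∀ H ∈ 𝓗 m, H.2.edgeSet.ncard = m) ∧
    (∀ m, ∀ H ∈ 𝓗 m, ∀ v, coreSize m ≤ (H.2.neighborSet v).ncard) ∧
    (∀ m m', ∀ H ∈ 𝓗 m, ∀ H' ∈ 𝓗 m', H.2.IsContained H'.2 → H = H') ∧
    ∀ m, 0 < coreSize m → forcedEdgeCount m ≤ m →
      (sideSize m * longSideSize m).choose (m - forcedEdgeCount m) ≤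
        (Fintype.card (EncodingVertex m))! * (𝓗 m).card := by
  have hrep : ∀ m, ∃ 𝓗 : Finset FinGraph,
      (∀ H ∈ 𝓗, 0 < coreSize m ∧ ∃ S : Finset (Fin (sideSize m) × Fin (longSideSize m)),
        forcedEdgeCount m + S.card = m ∧
        Nonempty (layerGraph m.sqrt (coreSize m) S ≃g H.2)) ∧
      (∀ H ∈ 𝓗, ∀ H' ∈ 𝓗, Nonempty (H.2 ≃g H'.2) → H = H') ∧
      (0 < coreSize m → forcedEdgeCount m ≤ m →
        (sideSize m * longSideSize m).choose (m - forcedEdgeCount m) ≤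
          (Fintype.card (EncodingVertex m))! * 𝓗.card) := by
    intro m
    by_cases hm : 0 < coreSize m ∧ forcedEdgeCount m ≤ m
    · obtain ⟨𝓗, h1, h2, h3⟩ := exists_isomorphism_representatives
        ((Finset.powersetCard (m - forcedEdgeCount m) Finset.univ).map
          ⟨_, layerGraph_injective m.sqrt (coreSize m) (sideSize m) (longSideSize m)⟩)
      refine ⟨𝓗, fun H hH => ⟨hm.1, ?_⟩, h3, fun _ _ => ?_⟩
      · obtain ⟨G, hG, hGH⟩ := h2 H hH
        obtain ⟨S, hS, rfl⟩ := Finset.mem_map.1 hG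
        have hcard := (Finset.mem_powersetCard.1 hS).2
        exact ⟨S, by omega, hGH⟩
      · simpa using h1
    · exact ⟨∅, by simp, by simp, fun h h' => absurd ⟨h, h'⟩ hm⟩
  choose 𝓗 h1 h2 h3 using hrep
  have hedge : ∀ m, ∀ H ∈ 𝓗 m, H.2.edgeSet.ncard = m := by
    intro m H hH
    obtain ⟨-, S, hS, ⟨e⟩⟩ := h1 m H hH
    rw [← e.ncard_edgeSet_eq, ncard_edgeSet_layerGraph]
    exact hS
  refine ⟨𝓗, hedge, fun m H hH v => ?_, fun m m' H hH H' hH' hle => ?_, h3⟩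
  · obtain ⟨-, S, -, ⟨e⟩⟩ := h1 m H hH
    calc _ ≤ _ := le_ncard_neighborSet_layerGraph S (e.symm v)
      _ ≤ _ := e.toCopy.ncard_neighborSet_le (e.symm v)
      _ = _ := by
        change (H.2.neighborSet (e (e.symm v))).ncard = _
        rw [e.apply_symm_apply]
  · have hmm : m ≤ m' := by
      rw [← hedge m H hH, ← hedge m' H' hH']
      exact hle.ncard_edgeSet_le
    obtain ⟨hc, S, hS, ⟨e⟩⟩ := h1 m H hH
    obtain ⟨-, S', hS', ⟨e'⟩⟩ := h1 m' H' hH'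
    have hle' : (layerGraph m.sqrt (coreSize m) S).IsContained
        (layerGraph m'.sqrt (coreSize m') S') :=
      (e.isContained.trans hle).trans e'.isContained'
    rcases hmm.eq_or_lt with rfl | hlt
    · refine h2 m H hH H' hH' (hle.nonempty_iso ?_ ?_)
      · exact (Nat.card_congr (e'.symm.toEquiv.trans e.toEquiv)).le
      · rw [hedge m H hH, hedge m H' hH']
    -- For equal square roots the graph with fewer edges has more vertices; otherwise its odd cycle
    -- is shorter.
    · rcases (Nat.sqrt_le_sqrt hmm).eq_or_lt with hs | hs
      · obtain ⟨f⟩ := hle'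
        exact absurd (Fintype.card_le_of_injective f f.injective)
          (not_le.2 (card_encodingVertex_lt hlt hs))
      · exact absurd hle' (not_layerGraph_isContained_of_lt hc hs)

end Antichain

/-! ### Size of the antichain. -/

section Counting

open scoped Nat

theorem tendsto_coreSize : Tendsto coreSize atTop atTop := by
  refine tendsto_atTop.2 fun b => eventually_atTop.2 ⟨(2 ^ b) ^ 2, fun m hm => ?_⟩
  refine Nat.le_log_of_pow_le one_lt_two ?_
  exact Nat.le_sqrt'.2 hm

/-- This sets the threshold 16: with `2 ^ L ≤ √m`, it lets the lower-order terms in the estimates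
below be absorbed. -/
theorem ten_mul_pow_three_le_two_pow {L : ℕ} (hL : 16 ≤ L) : 10 * L ^ 3 ≤ 2 ^ L := by
  induction L, hL using Nat.le_induction with
  | base => norm_num
  | succ n hn ih =>
    rw [pow_succ 2 n]
    have h1 : (n + 1) ^ 3 = n ^ 3 + 3 * n ^ 2 + 3 * n + 1 := by ring
    have h2 : 16 * n ^ 2 ≤ n ^ 3 := by rw [pow_succ n 2, mul_comm]; exact Nat.mul_le_mul_left _ hn
    have h3 : 16 * n ≤ n ^ 2 := by rw [sq]; exact Nat.mul_le_mul_right _ hn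
    omega

variable {m : ℕ}

theorem two_pow_coreSize_le (hL : 16 ≤ coreSize m) : 2 ^ coreSize m ≤ m.sqrt := by
  refine Nat.pow_log_le_self 2 fun h => ?_
  rw [coreSize, h] at hL
  simp at hL

theorem card_encodingVertex_mul_le (hL : 16 ≤ coreSize m) :
    Fintype.card (EncodingVertex m) * coreSize m ^ 2 ≤ 3 * m := by
  have hk := (ten_mul_pow_three_le_two_pow hL).trans (two_pow_coreSize_le hL)
  have hN : sideSize m * coreSize m ^ 2 ≤ m.sqrt ^ 2 := Nat.div_mul_le_self _ _
  have hm : m.sqrt ^ 2 ≤ m := Nat.sqrt_le' m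
  rw [card_layerVertex, longSideSize]
  generalize coreSize m = L at *
  generalize sideSize m = N at *
  generalize m.sqrt = k at *
  have h1 : (k + 1) ^ 2 - m ≤ 2 * k + 1 := by
    have : (k + 1) ^ 2 = k ^ 2 + 2 * k + 1 := by ring
    omega
  have hk1 : 1 ≤ k := by
    have : 0 < L ^ 3 := by positivity
    omega
  calc _ ≤ ((2 * k + 3) * L + (N + (N + (2 * k + 1)))) * L ^ 2 := by gcongr
    _ = 2 * (N * L ^ 2) + ((2 * k + 3) * L + (2 * k + 1)) * L ^ 2 := by ring
    _ ≤ 2 * k ^ 2 + ((5 * k) * L + (3 * k) * L) * L ^ 2 := by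
      gcongr
      · omega
      · calc 2 * k + 1 ≤ 3 * k * 1 := by omega
          _ ≤ 3 * k * L := by gcongr; omega
    _ = 2 * k ^ 2 + k * (8 * L ^ 3) := by ring
    _ ≤ 2 * k ^ 2 + k * k := by gcongr; omega
    _ ≤ 3 * m := by nlinarith

theorem forcedEdgeCount_mul_le (hL : 16 ≤ coreSize m) :
    forcedEdgeCount m * coreSize m ≤ 6 * m := by
  calc _ ≤ Fintype.card (EncodingVertex m) * (2 * coreSize m) * coreSize m :=
        Nat.mul_le_mul_right _ ncard_edgeSet_layerCore_le
    _ = 2 * (Fintype.card (EncodingVertex m) * coreSize m ^ 2) := by ring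
    _ ≤ 2 * (3 * m) := Nat.mul_le_mul_left _ (card_encodingVertex_mul_le hL)
    _ = 6 * m := by ring

theorem thirtytwo_mul_pow_four_le (hL : 16 ≤ coreSize m) : 32 * coreSize m ^ 4 ≤ m := by
  have hk := (ten_mul_pow_three_le_two_pow hL).trans (two_pow_coreSize_le hL)
  have hm : m.sqrt ^ 2 ≤ m := Nat.sqrt_le' m
  calc 32 * coreSize m ^ 4 ≤ 100 * coreSize m ^ 6 :=
        Nat.mul_le_mul (by norm_num) (Nat.pow_le_pow_right (by omega) (by norm_num))
    _ = (10 * coreSize m ^ 3) ^ 2 := by ring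
    _ ≤ m.sqrt ^ 2 := by gcongr
    _ ≤ m := hm

theorem sq_le_sideSize_mul (hL : 16 ≤ coreSize m) :
    m ^ 2 ≤ 16 * coreSize m ^ 4 * (sideSize m * longSideSize m) := by
  have hk := (ten_mul_pow_three_le_two_pow hL).trans (two_pow_coreSize_le hL)
  have hlt : m < (m.sqrt + 1) ^ 2 := Nat.lt_succ_sqrt' m
  have hL2 : 0 < coreSize m ^ 2 := by positivity
  have hN : m.sqrt ^ 2 < sideSize m * coreSize m ^ 2 + coreSize m ^ 2 := by
    have := Nat.lt_succ_iff.2 (le_refl (m.sqrt ^ 2 / coreSize m ^ 2))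
    rw [Nat.div_lt_iff_lt_mul hL2] at this
    rw [sideSize]
    nlinarith
  have hle : sideSize m ≤ longSideSize m := Nat.le_add_right _ _
  have key : m ≤ 4 * (sideSize m * coreSize m ^ 2) := by
    generalize sideSize m = N at *
    generalize coreSize m = L at *
    generalize m.sqrt = k at *
    have h2 : 16 * L ^ 2 ≤ L ^ 3 := by rw [pow_succ L 2, mul_comm]; exact Nat.mul_le_mul_left _ hL
    have h3 : 160 * L ^ 2 ≤ k := by omega
    have h4 : 1 ≤ k := by omega
    have h5 : k ≤ k ^ 2 := by nlinarith
    have h6 : 160 * k ≤ k ^ 2 := by nlinarith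
    have h7 : (k + 1) ^ 2 = k ^ 2 + 2 * k + 1 := by ring
    omega
  calc m ^ 2 ≤ (4 * (sideSize m * coreSize m ^ 2)) ^ 2 := by gcongr
    _ = 16 * coreSize m ^ 4 * (sideSize m * sideSize m) := by ring
    _ ≤ _ := by gcongr

theorem log_le_four_mul_coreSize (hL : 16 ≤ coreSize m) : Real.log m ≤ 4 * coreSize m := by
  have h1 : m < (m.sqrt + 1) ^ 2 := Nat.lt_succ_sqrt' m
  have h2 : m.sqrt + 1 ≤ 2 ^ (coreSize m + 1) := Nat.lt_pow_succ_log_self one_lt_two _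
  have h3 : m ≤ 2 ^ ((coreSize m + 1) * 2) := by
    rw [pow_mul]
    exact h1.le.trans (Nat.pow_le_pow_left h2 2)
  have hm : 0 < m := (Nat.mul_pos (by norm_num) (Nat.pow_pos (by omega))).trans_le
    (thirtytwo_mul_pow_four_le hL)
  have h4 : Real.log m ≤ Real.log ((2 : ℝ) ^ ((coreSize m + 1) * 2)) :=
    Real.log_le_log (by exact_mod_cast hm) (by exact_mod_cast h3)
  rw [Real.log_pow] at h4
  have h5 := Real.log_two_lt_d9
  have hL' : (16 : ℝ) ≤ coreSize m := by exact_mod_cast hL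
  push_cast at h4
  nlinarith

theorem coreSize_le_log (hL : 16 ≤ coreSize m) : (coreSize m : ℝ) ≤ Real.log m := by
  have h1 : 2 ^ (coreSize m * 2) ≤ m := by
    rw [pow_mul]
    exact (Nat.pow_le_pow_left (two_pow_coreSize_le hL) 2).trans (Nat.sqrt_le' m)
  have h4 : Real.log ((2 : ℝ) ^ (coreSize m * 2)) ≤ Real.log m :=
    Real.log_le_log (by positivity) (by exact_mod_cast h1)
  rw [Real.log_pow] at h4
  have h5 := Real.log_two_gt_d9
  have hL' : (16 : ℝ) ≤ coreSize m := by exact_mod_cast hL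
  push_cast at h4
  nlinarith

/-- The binomial is at least `(P + 1 - M) ^ M / M !`; here the base is at least `X * M` and `M ! ≤ M
^ M`. -/
theorem pow_le_choose_of_sq_le {P M m : ℕ} {X : ℝ} (hX : 0 ≤ X) (hM : M ≤ m)
    (hP : X * m + m ≤ P) : X ^ M ≤ P.choose M := by
  have h1 := Nat.pow_le_choose (α := ℝ) M P
  refine le_trans ?_ h1
  have hMP : (M : ℝ) ≤ P := by
    have : (M : ℝ) ≤ m := by exact_mod_cast hM
    have : 0 ≤ X * m := by positivity
    linarith
  have hMP' : M ≤ P := by exact_mod_cast hMP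
  have hsub : X * M ≤ ((P + 1 - M : ℕ) : ℝ) := by
    rw [Nat.cast_sub (by omega)]
    have h2 : (M : ℝ) ≤ m := by exact_mod_cast hM
    have h3 : X * M ≤ X * m := by gcongr
    push_cast
    linarith
  rw [le_div_iff₀ (by positivity)]
  calc X ^ M * (M ! : ℝ) ≤ X ^ M * (M : ℝ) ^ M := by
        gcongr
        exact_mod_cast Nat.factorial_le_pow M
    _ = (X * M) ^ M := (mul_pow _ _ _).symm
    _ ≤ _ := by gcongr

/-- The antichain has `exp (m log m + O (m log log m))` members with `m` edges. -/
theorem exp_le_of_choose_le {b : ℕ} (hL : 16 ≤ coreSize m)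
    (hb : forcedEdgeCount m ≤ m → (sideSize m * longSideSize m).choose (m - forcedEdgeCount m) ≤
        (Fintype.card (EncodingVertex m))! * b) :
    Real.exp (m * Real.log m + -44 * (m * Real.log (Real.log m))) ≤ b := by
  have hV := card_encodingVertex_mul_le hL
  have hF := forcedEdgeCount_mul_le hL
  have h32 := thirtytwo_mul_pow_four_le hL
  have hP := sq_le_sideSize_mul hL
  have hlog := log_le_four_mul_coreSize hL
  have hlog' := coreSize_le_log hL
  set L := coreSize m with hLdef
  have hFm : forcedEdgeCount m ≤ m := by nlinarith
  replace hb := hb hFm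
  set M := m - forcedEdgeCount m with hM
  set v := Fintype.card (EncodingVertex m) with hv
  set P := sideSize m * longSideSize m with hPdef
  have hL' : (16 : ℝ) ≤ L := by exact_mod_cast hL
  have hLpos : (0 : ℝ) < L := by linarith
  have hmpos : 0 < m := (Nat.mul_pos (by norm_num) (Nat.pow_pos (by omega))).trans_le h32
  have hm' : (0 : ℝ) < m := by exact_mod_cast hmpos
  -- There are `P ≥ m² / (16 * L ^ 4)` free pairs; half of this is `X * m`, the other half absorbs
  -- the extra `m`.
  set X : ℝ := m / (32 * L ^ 4) with hXdef
  have h32' : (32 : ℝ) * L ^ 4 ≤ m := by exact_mod_cast h32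
  have hX1 : 1 ≤ X := by rw [hXdef, le_div_iff₀ (by positivity)]; linarith
  have hXP : X * m + m ≤ P := by
    have h1 : (m : ℝ) ^ 2 ≤ 16 * L ^ 4 * P := by exact_mod_cast hP
    have h2 : X * m + m ≤ 2 * (X * m) := by nlinarith
    refine h2.trans ?_
    rw [hXdef]
    have h3 : 2 * ((m : ℝ) / (32 * L ^ 4) * m) = m ^ 2 / (16 * L ^ 4) := by field_simp; norm_num
    rw [h3, div_le_iff₀ (by positivity)]
    linarith
  have hchoose : X ^ M ≤ (v ! : ℝ) * b :=
    (pow_le_choose_of_sq_le (by linarith) (Nat.sub_le _ _) hXP).trans (by exact_mod_cast hb)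
  rw [← hLdef] at hV
  have hvm : v ≤ m := by
    have h3 : v * 3 ≤ v * L ^ 2 := Nat.mul_le_mul_left _ (by nlinarith)
    omega
  have hfact : (v ! : ℝ) ≤ Real.exp (12 * m) := by
    have h1 : (v ! : ℝ) ≤ (m : ℝ) ^ v := by
      exact_mod_cast (Nat.factorial_le_pow v).trans (Nat.pow_le_pow_left hvm v)
    refine h1.trans ?_
    rw [← Real.exp_log (by positivity : (0 : ℝ) < (m : ℝ) ^ v), Real.log_pow, Real.exp_le_exp]
    have h2 : (v : ℝ) * L ^ 2 ≤ 3 * m := by exact_mod_cast hV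
    calc (v : ℝ) * Real.log m ≤ v * (4 * L) := by gcongr
      _ ≤ v * (4 * L ^ 2) := by gcongr; nlinarith
      _ ≤ 12 * m := by linarith
  -- The 28 is 4 from `log 32` plus 24 from the forced edges. Adding 12 for `v !` and the 4 already
  -- at `log log m` gives the final 44, as `log log m ≥ 1`.
  have hXM : Real.exp (m * Real.log m - 28 * m - 4 * (m * Real.log (Real.log m))) ≤ X ^ M := by
    rw [← Real.exp_log (by positivity : 0 < X ^ M), Real.log_pow, Real.exp_le_exp]
    have hlogX : Real.log X = Real.log m - Real.log 32 - 4 * Real.log L := by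
      rw [hXdef, Real.log_div (by positivity) (by positivity),
        Real.log_mul (by norm_num) (by positivity), Real.log_pow]
      push_cast
      ring
    have hlog32 : Real.log 32 ≤ 4 := by
      have : (32 : ℝ) = 2 ^ 5 := by norm_num
      rw [this, Real.log_pow]
      have := Real.log_two_lt_d9
      push_cast
      linarith
    have hlogL : Real.log L ≤ Real.log (Real.log m) := Real.log_le_log hLpos hlog'
    have hX0 : 0 ≤ Real.log X := Real.log_nonneg hX1
    have hXm : Real.log X ≤ Real.log m := by
      refine Real.log_le_log (by linarith) (div_le_self hm'.le ?_)
      have : (1 : ℝ) ≤ L ^ 4 := one_le_pow₀ (by linarith)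
      linarith
    have hMcast : (M : ℝ) = m - forcedEdgeCount m := by rw [hM, Nat.cast_sub hFm]
    have hF' : (forcedEdgeCount m : ℝ) * L ≤ 6 * m := by exact_mod_cast hF
    have h1 : (forcedEdgeCount m : ℝ) * Real.log X ≤ 24 * m := by
      calc (forcedEdgeCount m : ℝ) * Real.log X ≤ forcedEdgeCount m * (4 * L) := by
            gcongr
            linarith
        _ ≤ 24 * m := by linarith
    rw [hMcast, sub_mul]
    have h2 : m * (Real.log m - 4 - 4 * Real.log (Real.log m)) ≤ m * Real.log X := by
      rw [hlogX]
      gcongr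
    linarith
  have hll : 1 ≤ Real.log (Real.log m) := by
    rw [← Real.log_exp 1]
    refine Real.log_le_log (Real.exp_pos _) ?_
    have := Real.exp_one_lt_d9
    linarith
  have hfin : Real.exp (m * Real.log m + -44 * (m * Real.log (Real.log m))) * Real.exp (12 * m) ≤
      b * Real.exp (12 * m) := by
    calc _ ≤ Real.exp (m * Real.log m - 28 * m - 4 * (m * Real.log (Real.log m))) := by
          rw [← Real.exp_add, Real.exp_le_exp]
          nlinarith
      _ ≤ _ := hXM
      _ ≤ _ := hchoose
      _ ≤ Real.exp (12 * m) * b := by gcongr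
      _ = _ := mul_comm _ _
  exact le_of_mul_le_mul_right hfin (Real.exp_pos _)

end Counting

/-! ### Counting sparse graphs. -/

section UpperBound

open scoped Nat

theorem sparseGraphCount_le_sum (m : ℕ) :
    sparseGraphCount m ≤ ∑ i ∈ Finset.range (m + 1), (m * (2 * m + 1)).choose i := by
  classical
  have hcard : Fintype.card (Sym2 (Fin (2 * m))) = m * (2 * m + 1) := by
    rw [Sym2.card, Fintype.card_fin, Nat.choose_two_right, Nat.add_sub_cancel]
    refine Nat.div_eq_of_eq_mul_left two_pos ?_
    ring
  let T : Finset (Finset (Sym2 (Fin (2 * m)))) :=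
    (Finset.range (m + 1)).biUnion fun i => Finset.powersetCard i Finset.univ
  have hmem : ∀ K : {K : SimpleGraph (Fin (2 * m)) // K.edgeSet.ncard ≤ m}, K.1.edgeFinset ∈ T := by
    intro K
    have h1 : K.1.edgeFinset.card ≤ m := by
      rw [← Set.ncard_coe_finset, SimpleGraph.coe_edgeFinset]
      exact K.2
    simp [T, h1]
  calc sparseGraphCount m ≤ Nat.card T :=
        Nat.card_le_card_of_injective (fun K => (⟨K.1.edgeFinset, hmem K⟩ : T)) fun K K' h =>
          Subtype.ext (SimpleGraph.edgeFinset_inj.1 (congrArg Subtype.val h))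
    _ = T.card := by simp
    _ ≤ ∑ i ∈ Finset.range (m + 1), (Finset.powersetCard i
          (Finset.univ : Finset (Sym2 (Fin (2 * m))))).card := Finset.card_biUnion_le
    _ = _ := by simp only [Finset.card_powersetCard, Finset.card_univ, hcard]

theorem sparseGraphCount_le_exp {m : ℕ} (hm : 1 ≤ m) :
    (sparseGraphCount m : ℝ) ≤ Real.exp (m * Real.log m + 3 * m) := by
  have hm' : (1 : ℝ) ≤ m := by exact_mod_cast hm
  have h1 : (sparseGraphCount m : ℝ) ≤
      ∑ i ∈ Finset.range (m + 1), ((m * (2 * m + 1)).choose i : ℝ) := by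
    exact_mod_cast sparseGraphCount_le_sum m
  -- Splitting off `m ^ i / i !` leaves a partial exponential series, so the sum costs only a factor
  -- `exp m`.
  have h2 : ∀ i ∈ Finset.range (m + 1), ((m * (2 * m + 1)).choose i : ℝ) ≤
      (3 * m) ^ m * ((m : ℝ) ^ i / i !) := by
    intro i hi
    have him : i ≤ m := Nat.lt_succ_iff.1 (Finset.mem_range.1 hi)
    refine (Nat.choose_le_pow_div i _).trans ?_
    rw [← mul_div_assoc]
    gcongr
    calc ((m * (2 * m + 1) : ℕ) : ℝ) ^ i ≤ ((3 * m) * m) ^ i := by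
          gcongr
          push_cast
          nlinarith
      _ = (3 * m) ^ i * (m : ℝ) ^ i := mul_pow _ _ _
      _ ≤ (3 * m) ^ m * (m : ℝ) ^ i := by
          gcongr
          linarith
  calc (sparseGraphCount m : ℝ) ≤ ∑ i ∈ Finset.range (m + 1), (3 * m) ^ m * ((m : ℝ) ^ i / i !) :=
        h1.trans (Finset.sum_le_sum h2)
    _ = (3 * m) ^ m * ∑ i ∈ Finset.range (m + 1), (m : ℝ) ^ i / i ! := by rw [Finset.mul_sum]
    _ ≤ (3 * m) ^ m * Real.exp m := by
        gcongr
        exact Real.sum_le_exp_of_nonneg (by positivity) _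
    _ = Real.exp (m * (Real.log 3 + Real.log m) + m) := by
        rw [Real.exp_add, ← Real.log_mul (by norm_num) (by positivity), mul_comm (m : ℝ) (Real.log _),
          Real.exp_mul, Real.exp_log (by positivity), Real.rpow_natCast]
    _ ≤ _ := by
        rw [Real.exp_le_exp]
        have h3 : Real.log 3 ≤ 2 := by
          have := Real.log_le_sub_one_of_pos (show (0 : ℝ) < 3 by norm_num)
          linarith
        nlinarith

theorem natCast_pow_self_eq_exp {m : ℕ} (hm : 1 ≤ m) :
    ((m ^ m : ℕ) : ℝ) = Real.exp (m * Real.log m) := by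
  have hm' : (0 : ℝ) < m := by exact_mod_cast hm
  rw [mul_comm, Real.exp_mul, Real.exp_log hm', Real.rpow_natCast, Nat.cast_pow]

theorem intervalBound_le_exp {m : ℕ} (hm : 1 ≤ m) :
    ((2 * sparseGraphCount m + (2 * m + 3) + m ^ m : ℕ) : ℝ) ≤
      Real.exp (m * Real.log m + 6 * m) := by
  have hm' : (1 : ℝ) ≤ m := by exact_mod_cast hm
  have hlog : 0 ≤ m * Real.log m := mul_nonneg (by linarith) (Real.log_nonneg hm')
  have h1 := sparseGraphCount_le_exp hm
  have h2 : ((m ^ m : ℕ) : ℝ) ≤ Real.exp (m * Real.log m + 3 * m) := by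
    rw [natCast_pow_self_eq_exp hm, Real.exp_le_exp]
    linarith
  have h3 : (m : ℝ) ≤ Real.exp (m * Real.log m + 3 * m) := by
    have := Real.add_one_le_exp (m * Real.log m + 3 * m : ℝ)
    linarith
  have h4 : (8 : ℝ) ≤ Real.exp (3 * m) := by
    calc (8 : ℝ) = 2 ^ 3 := by norm_num
      _ ≤ Real.exp 1 ^ 3 := by
        gcongr
        have := Real.exp_one_gt_d9
        linarith
      _ = Real.exp 3 := by rw [← Real.exp_nat_mul]; norm_num
      _ ≤ _ := by rw [Real.exp_le_exp]; linarith
  have h5 : m * Real.log m + 6 * m = 3 * m + (m * Real.log m + 3 * m) := by ring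
  rw [h5, Real.exp_add]
  have h6 := mul_le_mul_of_nonneg_right h4 (Real.exp_pos (m * Real.log m + 3 * m)).le
  push_cast at h2 ⊢
  linarith

end UpperBound

theorem theorem1 :
    ∃ a b : ℕ → ℕ,
      -- `exp[m log m + O(m)] ≥ a_m ≥ b_m ≥ exp[m log m + O(m log log m)]`
      (∃ u : ℕ → ℝ, u =O[atTop] (fun m : ℕ => (m : ℝ)) ∧
        ∀ᶠ m : ℕ in atTop, (a m : ℝ) ≤ Real.exp (m * Real.log m + u m)) ∧
      (∀ m : ℕ, b m ≤ a m) ∧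
      (∃ v : ℕ → ℝ, v =O[atTop] (fun m : ℕ => (m : ℝ) * Real.log (Real.log m)) ∧
        ∀ᶠ m : ℕ in atTop, Real.exp (m * Real.log m + v m) ≤ (b m : ℝ)) ∧
      -- part 1
      (∀ 𝓕 : Set FinGraph, IsGraphFamily 𝓕 →
        (fun n : ℕ => (sat n 𝓕 : ℝ)) =O[atTop] (fun n : ℕ => (n : ℝ)) ∧
        (∀ m : ℕ, IsUnionOfAtMostIntervals (a m) {n : ℕ | sat n 𝓕 = m}) ∧
        (Tendsto (fun n : ℕ => sat n 𝓕) atTop atTop ∨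
          ∃ c : ℕ, ∀ᶠ n : ℕ in atTop, sat n 𝓕 = c)) ∧
      -- part 2
      (∀ s : ℕ → ℤ,
        (fun n : ℕ => (s n : ℝ)) =O[atTop] (fun n : ℕ => (n : ℝ)) →
        (∀ᶠ m : ℕ in atTop, IsUnionOfAtMostIntervals (b m) {n : ℕ | s n = (m : ℤ)}) →
        Tendsto s atTop atTop →
        ∃ 𝓕 : Set FinGraph, IsGraphFamily 𝓕 ∧ ∀ᶠ n : ℕ in atTop, (sat n 𝓕 : ℤ) = s n) ∧
      -- part 3
      (∀ m : ℕ, ∃ 𝓕 : Set FinGraph, IsGraphFamily 𝓕 ∧ 𝓕.Finite ∧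
        ∀ᶠ n : ℕ in atTop, sat n 𝓕 = m) := by
  obtain ⟨𝓗, hedge, hdeg, hanti, hcount⟩ := exists_graph_antichain
  -- The term `m ^ m`, added to `a` and capping `b`, makes `b m ≤ a m` immediate for every `m`
  -- without harming either asymptotic bound.
  refine ⟨fun m => 2 * sparseGraphCount m + (2 * m + 3) + m ^ m,
    fun m => min (m ^ m) (𝓗 m).card,
    ⟨fun m => 6 * m, (isBigO_refl _ _).const_mul_left 6, ?_⟩, ?_,
    ⟨fun m => -44 * (m * Real.log (Real.log m)), (isBigO_refl _ _).const_mul_left (-44), ?_⟩,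
    ?_, ?_, exists_finite_family_sat_eq⟩
  · filter_upwards [eventually_ge_atTop 1] with m hm
    exact intervalBound_le_exp hm
  · exact fun m => (min_le_left _ _).trans (Nat.le_add_left _ _)
  · filter_upwards [tendsto_coreSize.eventually_ge_atTop 16, eventually_ge_atTop 1] with m hL hm
    rw [Nat.cast_min]
    refine le_min ?_ (exp_le_of_choose_le hL (hcount m (by omega)))
    rw [natCast_pow_self_eq_exp hm, Real.exp_le_exp]
    have h1 : (1 : ℝ) ≤ Real.log m := by
      have h2 : (16 : ℝ) ≤ coreSize m := by exact_mod_cast hL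
      linarith [coreSize_le_log hL]
    have h3 : 0 ≤ (m : ℝ) * Real.log (Real.log m) := mul_nonneg m.cast_nonneg (Real.log_nonneg h1)
    linarith
  · intro 𝓕 h𝓕
    have hint : ∀ m, IsUnionOfAtMostIntervals (2 * sparseGraphCount m + (2 * m + 3) + m ^ m)
        {n | sat n 𝓕 = m} := fun m =>
      (isUnionOfAtMostIntervals_sat h𝓕 m).mono (Nat.le_add_right _ _)
    refine ⟨?_, hint, tendsto_atTop_or_eventually_eq hint⟩
    obtain ⟨C, hC⟩ := exists_sat_le_mul h𝓕
    refine IsBigO.of_bound C (Eventually.of_forall fun n => ?_)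
    rw [Real.norm_natCast, Real.norm_natCast]
    exact_mod_cast hC n
  · intro s hO hI hs
    exact exists_family_sat_eq_of_antichain tendsto_coreSize hedge hdeg hanti hO
      (hI.mono fun m h => h.mono (min_le_right _ _)) hs
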